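/- For $a,b,c\in\mathbb C$ let ${}_2F_1(a,b;c;z)$ denote the Gauss hypergeometric function: the sum of the Gauss series for $|z|<1$, continued analytically to $\mathbb C\setminus[1,\infty)$; on the cut $(1,\infty)$ it denotes the boundary value from above or from below (fix one of the two sides throughout; everything holds for either choice). Assume $c\notin\{0,-1,-2,\dots\}$ and $c-a-b+1\notin\{0,-1,-2,\dots\}$. For $n=0,1,2,\dots$ put $$f_n={}_2F_1(a,b;c+n;z),\qquad g_n=\frac{(-1)^n(1-z)^n\,\Gamma(c+n)}{\Gamma(c-a-b+1+n)}\;{}_2F_1(c-a+n,c-b+n;c-a-b+1+n;1-z),$$ and $$A(c)=c(c-1)(z-1),\quad B(c)=c\,[c-1-(2c-a-b-1)z],\quad C(c)=(c-a)(c-b)z .$$ A solution $(y_n)$ of a three-term recurrence is called minimal, and a solution $(w_n)$ dominant, if $(y_n)$, $(w_n)$ are linearly independent solutions with $y_n/w_n\to0$ as $n\to\infty$ (a solution is minimal, resp. dominant, if such a partner exists). 1. For $z\ne0,1$, $(f_n)$ and $(g_n)$ are linearly independent solutions of $$A(c+n)\,y_{n-1}+B(c+n)\,y_n+C(c+n)\,y_{n+1}=0,\qquad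 n\ge1 .$$ 2. If $a+b-c\notin\mathbb Z$ and $z\neq 0,1$, then $g_n$ is, up to a factor independent of $n$, the second term of the $(1-z)$-connection formula with $c$ replaced by $c+n$: for $n\ge 0$ the expression $$\frac{\Gamma(c)\,\Gamma(a+b-c)}{\Gamma(a)\Gamma(b)}(1-z)^{c-a-b}\,{}_2F_1(c-a,c-b;c-a-b+1;1-z)$$ with $c$ replaced by $c+n$ equals $\dfrac{\pi\,(1-z)^{c-a-b}}{\sin(\pi(a+b-c))\,\Gamma(a)\Gamma(b)}\,g_n$ (with $1/\Gamma=0$ at the poles of $\Gamma$). 3. For $z\ne0,1$, as $n\to\infty$, $B(c+n)/C(c+n)\to\alpha=-\frac{2z-1}{z}$ and $A(c+n)/C(c+n)\to\beta=\frac{z-1}{z}$. The roots of $t^2+\alpha t+\beta=0$ are $t_1=1$ and $t_2=\frac{z-1}{z}$; $|t_1|=|t_2|$ if and only if $\Re z=\frac12$, and $|t_1|>|t_2|$ if and only if $\Re z>\frac12$. 4. For $z\ne0,1$, as $n\to\infty$, $f_n=1+O(1/n)$, $f_{n+1}/f_n\to t_1$ and $g_{n+1}/g_n\to t_2$. 5.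 If $\Re z<\frac12$ and $z\ne0$, then $(f_n)$ is a minimal and $(g_n)$ a dominant solution; moreover, on every compact subset of $\{z\neq0:\Re z<\frac12\}$, $g_n$ has no zeros for all large $n$ and $f_n/g_n\to0$ uniformly. 6. If $\Re z>\frac12$ and $z\ne1$, then $(g_n)$ is a minimal and $(f_n)$ a dominant solution; moreover, on every compact subset of $\{z\ne1:\Re z>\frac12\}$, $f_n$ has no zeros for all large $n$ and $g_n/f_n\to0$ uniformly. -/

import Mathlib

open Filter Topology

/-- The plane cut along `[1, ∞)`. -/
def cutPlane : Set ℂ := {z | 1 - z ∈ Complex.slitPlane}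

/-- `F` is holomorphic on the plane cut along `[1, ∞)` and agrees on the unit disk with the Gauss
series `∑ (a)ₖ (b)ₖ / ((c)ₖ k!) zᵏ`. By the identity theorem two such functions agree on the
cut plane. -/
def IsGaussContinuation (a b c : ℂ) (F : ℂ → ℂ) : Prop :=
  DifferentiableOn ℂ F cutPlane ∧ ∀ z : ℂ, ‖z‖ < 1 → F z = ordinaryHypergeometric a b c z

/-- The principal branch of the Gauss hypergeometric function on the cut plane: the analytic
continuation of the Gauss series. (Only its values on `cutPlane` are meaningful.) -/
noncomputable def gaussPrincipal (a b c : ℂ) : ℂ → ℂ :=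
  Classical.epsilon (IsGaussContinuation a b c)

/-- The two sides from which the cut `(1, ∞)` can be approached. -/
inductive CutSide where
  | above
  | below

/-- The open half-plane on the given side of the real axis. -/
def CutSide.halfPlane : CutSide → Set ℂ
  | .above => {w | 0 < w.im}
  | .below => {w | w.im < 0}

open Classical in
/-- The Gauss hypergeometric function `₂F₁(a, b; c; z)`: the principal branch off the cut, and on
the cut `(1, ∞)` the boundary value of the principal branch from the side `σ`. -/
noncomputable def gauss2F1 (σ : CutSide) (a b c z : ℂ) : ℂ :=
  if z ∈ cutPlane then gaussPrincipal a b c z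
  else limUnder (𝓝[σ.halfPlane] z) (gaussPrincipal a b c)

/-- `y` solves the three-term recurrence `A n * y (n-1) + B n * y n + C n * y (n+1) = 0`,
`n = 1, 2, …`. -/
def IsRecSolution (A B C : ℕ → ℂ) (y : ℕ → ℂ) : Prop :=
  ∀ n : ℕ, 1 ≤ n → A n * y (n - 1) + B n * y n + C n * y (n + 1) = 0

/-- `f` and `g` are linearly independent solutions of the recurrence and `f n / g n → 0`
(in particular `g n ≠ 0` for large `n`). -/
def IsMinimalDominantPair (A B C : ℕ → ℂ) (f g : ℕ → ℂ) : Prop :=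
  IsRecSolution A B C f ∧ IsRecSolution A B C g ∧ LinearIndependent ℂ ![f, g] ∧
    (∀ᶠ n in atTop, g n ≠ 0) ∧ Tendsto (fun n => f n / g n) atTop (𝓝 0)

/-- `f` is a minimal solution of the recurrence. -/
def IsMinimalSolution (A B C : ℕ → ℂ) (f : ℕ → ℂ) : Prop :=
  ∃ g : ℕ → ℂ, IsMinimalDominantPair A B C f g

/-- `g` is a dominant solution of the recurrence. -/
def IsDominantSolution (A B C : ℕ → ℂ) (g : ℕ → ℂ) : Prop :=
  ∃ f : ℕ → ℂ, IsMinimalDominantPair A B C f g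

/-- The coefficient of `y (n-1)`, as a function of the third parameter. -/
def A13 (c z : ℂ) : ℂ := c * (c - 1) * (z - 1)

/-- The coefficient of `y n`, as a function of the third parameter. -/
def B13 (a b c z : ℂ) : ℂ := c * (c - 1 - (2 * c - a - b - 1) * z)

/-- The coefficient of `y (n+1)`, as a function of the third parameter. -/
def C13 (a b c z : ℂ) : ℂ := (c - a) * (c - b) * z

/-- `A n = A13 (c + n)`. -/
def recA (c z : ℂ) (n : ℕ) : ℂ := A13 (c + n) z

/-- `B n = B13 (c + n)`. -/
def recB (a b c z : ℂ) (n : ℕ) : ℂ := B13 a b (c + n) z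

/-- `C n = C13 (c + n)`. -/
def recC (a b c z : ℂ) (n : ℕ) : ℂ := C13 a b (c + n) z

/-- `f_n = ₂F₁(a, b; c + n; z)`. -/
noncomputable def solF (σ : CutSide) (a b c z : ℂ) (n : ℕ) : ℂ := gauss2F1 σ a b (c + n) z

/-- `g_n = (-1)ⁿ (1-z)ⁿ Γ(c+n) / Γ(c-a-b+1+n) ₂F₁(c-a+n, c-b+n; c-a-b+1+n; 1-z)`. -/
noncomputable def solG (σ : CutSide) (a b c z : ℂ) (n : ℕ) : ℂ :=
  (-1) ^ n * (1 - z) ^ n * Complex.Gamma (c + n) / Complex.Gamma (c - a - b + 1 + n) *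
    gauss2F1 σ (c - a + n) (c - b + n) (c - a - b + 1 + n) (1 - z)

/-- The second term of the formula connecting `₂F₁(a, b; c; z)` with functions of `1 - z`:
`Γ(c) Γ(a+b-c) / (Γ(a) Γ(b)) (1-z)^(c-a-b) ₂F₁(c-a, c-b; c-a-b+1; 1-z)`. -/
noncomputable def connectionTerm (σ : CutSide) (a b c z : ℂ) : ℂ :=
  Complex.Gamma c * Complex.Gamma (a + b - c) / (Complex.Gamma a * Complex.Gamma b) *
    (1 - z) ^ (c - a - b) * gauss2F1 σ (c - a) (c - b) (c - a - b + 1) (1 - z)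

/-! Write `F(c)` for `₂F₁(a, b; c; z)`. Comparing coefficients shows that the pair `F(c)`, `F(c+1)`
solves a first-order linear system in `z` whose finite singularities are only `0` and `1`
(`gauss_theta_right`, `gauss_deriv_right`). Eliminating a derivative gives the recurrence for `f_n`.
Gronwall's inequality for the same system shows that `F(c)` stays bounded up to each side of the
cut, so that the boundary values exist. The continuation itself comes from Euler's integral when `0
< Re b < Re c`; contiguous relations then reach all admissible parameters.

The asymptotics `f_n = 1 + O(1/n)` has two sources. Away from the cut, the Beta weight in Euler's
integral concentrates at `t = 0`, where `(1 - tz)^(-a) = 1 + O(t)`. This argument does not reach the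
cut. For `Re z > 1/2` the recurrence is therefore read as a rule for increments: each is about
`(z-1)/z` times the previous one, plus an `O(1/n²)` multiple of the solution. As `|(z-1)/z| < 1`,
the sequence converges at rate `1/n` with constants uniform up to the cut
(`exists_bound_of_increment_le`). The limit is `1` at points off the cut, and the bound passes to
boundary values.

For `g_n`, Euler's transformation (`gauss2F1_euler`) removes `n` from the upper parameters: `g_n` is
a constant times `((z-1)/z)^n Γ(c+n)/Γ(c-a-b+1+n)` times `₂F₁(1-b, 1-a; c-a-b+1+n; 1-z)`
(`solG_eq`). The last factor is of the type already treated, so its recurrence and its limit `1`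
carry over. The quotient of Gamma functions grows or decays only polynomially, so `|(z-1)/z|`
decides which solution is minimal, and `|z-1| < |z|` means `Re z > 1/2`. -/

/-- The coefficients of the Gauss series. -/
noncomputable def gaussCoeff (a b c : ℂ) (k : ℕ) : ℂ := ordinaryHypergeometricCoefficient a b c k

/-! ### Contiguous relations for the coefficients of the Gauss series -/

section Coefficients

variable {a b c : ℂ}

theorem ascPochhammer_eval_ne_zero (hc : ∀ m : ℕ, c ≠ -(m : ℂ)) (k : ℕ) :
    (ascPochhammer ℂ k).eval c ≠ 0 := by
  rw [Ne, ascPochhammer_eval_eq_zero_iff]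
  rintro ⟨m, -, hm⟩
  exact hc m (by rw [hm, neg_neg])

theorem ascPochhammer_succ_eval_left (k : ℕ) (s : ℂ) :
    (ascPochhammer ℂ (k + 1)).eval s = s * (ascPochhammer ℂ k).eval (s + 1) := by
  simp [ascPochhammer_succ_left]

theorem not_neg_nat_add (hc : ∀ m : ℕ, c ≠ -(m : ℂ)) (n : ℕ) : ∀ m : ℕ, c + n ≠ -(m : ℂ) := by
  intro m h
  refine hc (m + n) ?_
  push_cast
  linear_combination h

theorem not_neg_nat_add_one (hc : ∀ m : ℕ, c ≠ -(m : ℂ)) : ∀ m : ℕ, c + 1 ≠ -(m : ℂ) := by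
  simpa using not_neg_nat_add hc 1

theorem add_nat_ne_zero (hc : ∀ m : ℕ, c ≠ -(m : ℂ)) (n : ℕ) : c + n ≠ 0 := by
  intro h
  exact hc n (by linear_combination h)

theorem ne_zero_of_not_neg_nat (hc : ∀ m : ℕ, c ≠ -(m : ℂ)) : c ≠ 0 := by
  simpa using hc 0

theorem gaussCoeff_zero : gaussCoeff a b c 0 = 1 := by
  simp [gaussCoeff, ordinaryHypergeometricCoefficient]

theorem gaussCoeff_succ (hc : ∀ m : ℕ, c ≠ -(m : ℂ)) (k : ℕ) :
    (k + 1) * gaussCoeff a b c (k + 1) = (a + k) * (b + k) / (c + k) * gaussCoeff a b c k := by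
  have h1 := add_nat_ne_zero hc k
  have h2 := ascPochhammer_eval_ne_zero hc k
  have h3 : (k.factorial : ℂ) ≠ 0 := by exact_mod_cast k.factorial_ne_zero
  have h4 : (k + 1 : ℂ) ≠ 0 := by exact_mod_cast k.succ_ne_zero
  simp only [gaussCoeff, ordinaryHypergeometricCoefficient, ascPochhammer_succ_eval,
    Nat.factorial_succ, Nat.cast_mul, Nat.cast_succ]
  field_simp

theorem gaussCoeff_succ_shift (hc : ∀ m : ℕ, c ≠ -(m : ℂ)) (k : ℕ) :
    (k + 1) * gaussCoeff a b c (k + 1) = a * b / c * gaussCoeff (a + 1) (b + 1) (c + 1) k := by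
  have h1 := ne_zero_of_not_neg_nat hc
  have h2 := ascPochhammer_eval_ne_zero (not_neg_nat_add_one hc) k
  have h3 : (k.factorial : ℂ) ≠ 0 := by exact_mod_cast k.factorial_ne_zero
  have h4 : (k + 1 : ℂ) ≠ 0 := by exact_mod_cast k.succ_ne_zero
  simp only [gaussCoeff, ordinaryHypergeometricCoefficient, ascPochhammer_succ_eval_left,
    Nat.factorial_succ, Nat.cast_mul, Nat.cast_succ]
  field_simp

theorem gaussCoeff_add_one_right (hc : ∀ m : ℕ, c ≠ -(m : ℂ)) (k : ℕ) :
    gaussCoeff a b (c + 1) k = c / (c + k) * gaussCoeff a b c k := by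
  have h1 := ne_zero_of_not_neg_nat hc
  have h2 := ascPochhammer_eval_ne_zero (not_neg_nat_add_one hc) k
  have h3 := ascPochhammer_eval_ne_zero hc k
  have h4 := add_nat_ne_zero hc k
  have h6 : (k.factorial : ℂ) ≠ 0 := by exact_mod_cast k.factorial_ne_zero
  have h5 : (ascPochhammer ℂ k).eval c * (c + k) = c * (ascPochhammer ℂ k).eval (c + 1) := by
    rw [← ascPochhammer_succ_eval, ascPochhammer_succ_eval_left]
  simp only [gaussCoeff, ordinaryHypergeometricCoefficient]
  field_simp
  linear_combination (ascPochhammer ℂ k).eval a * (ascPochhammer ℂ k).eval b * h5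

theorem gaussCoeff_add_one_middle (hc : ∀ m : ℕ, c ≠ -(m : ℂ)) (k : ℕ) :
    gaussCoeff a (b + 1) c (k + 1) - gaussCoeff a b c (k + 1) =
      a / c * gaussCoeff (a + 1) (b + 1) (c + 1) k := by
  have h1 := ne_zero_of_not_neg_nat hc
  have h2 := ascPochhammer_eval_ne_zero (not_neg_nat_add_one hc) k
  have h3 : (k.factorial : ℂ) ≠ 0 := by exact_mod_cast k.factorial_ne_zero
  have h4 : (k + 1 : ℂ) ≠ 0 := by exact_mod_cast k.succ_ne_zero
  simp only [gaussCoeff, ordinaryHypergeometricCoefficient, ascPochhammer_succ_eval_left k a,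
    ascPochhammer_succ_eval_left k b, ascPochhammer_succ_eval_left k c, ascPochhammer_succ_eval k,
    Nat.factorial_succ, Nat.cast_mul, Nat.cast_succ]
  field_simp
  ring

end Coefficients

/-! ### Derivatives and contiguous relations in the unit disk -/

section Disk

variable {a b c z : ℂ}

/-- If a parameter is a nonpositive integer the formal series is a polynomial (for `c` because the
inverse of zero is zero) and the radius is infinite. Otherwise it is exactly `1`. -/
theorem one_le_radius_gaussSeries (a b c : ℂ) : 1 ≤ (ordinaryHypergeometricSeries ℂ a b c).radius := by
  by_cases ha : ∃ k : ℕ, a = -(k : ℂ)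
  · obtain ⟨k, rfl⟩ := ha
    rw [ordinaryHypergeometric_radius_top_of_neg_nat₁]
    exact le_top
  by_cases hb : ∃ k : ℕ, b = -(k : ℂ)
  · obtain ⟨k, rfl⟩ := hb
    rw [ordinaryHypergeometric_radius_top_of_neg_nat₂]
    exact le_top
  by_cases hc : ∃ k : ℕ, c = -(k : ℂ)
  · obtain ⟨k, rfl⟩ := hc
    rw [ordinaryHypergeometric_radius_top_of_neg_nat₃]
    exact le_top
  push Not at ha hb hc
  refine (ordinaryHypergeometricSeries_radius_eq_one ℂ a b c fun k => ⟨?_, ?_, ?_⟩).ge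
  · exact fun h => ha k (by rw [h, neg_neg])
  · exact fun h => hb k (by rw [h, neg_neg])
  · exact fun h => hc k (by rw [h, neg_neg])

theorem summable_norm_gaussCoeff (a b c : ℂ) {r : ℝ} (h0 : 0 ≤ r) (h : r < 1) :
    Summable fun k => ‖gaussCoeff a b c k‖ * r ^ k := by
  have h1 : ‖(r : ℂ)‖ = r := by simp [abs_of_nonneg h0]
  have := (ordinaryHypergeometricSeries ℂ a b c).summable_norm_apply (x := (r : ℂ)) (by
    have : ‖(r : ℂ)‖ₑ < 1 := by
      rw [← ofReal_norm, h1]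
      exact ENNReal.ofReal_lt_one.2 h
    simpa using this.trans_le (one_le_radius_gaussSeries a b c))
  refine this.congr fun k => ?_
  rw [ordinaryHypergeometricSeries_apply_eq, norm_smul, norm_pow, h1]
  rfl

theorem hasSum_gauss (a b c : ℂ) (h : ‖z‖ < 1) :
    HasSum (fun k => gaussCoeff a b c k * z ^ k) (ordinaryHypergeometric a b c z) := by
  have h1 : Summable fun k => gaussCoeff a b c k * z ^ k := by
    refine .of_norm ((summable_norm_gaussCoeff a b c (norm_nonneg z) h).congr fun k => ?_)
    rw [norm_mul, norm_pow]
  have h2 : ordinaryHypergeometric a b c z = ∑' k, gaussCoeff a b c k * z ^ k := by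
    rw [ordinaryHypergeometric_eq_tsum]
    rfl
  rw [h2]
  exact h1.hasSum

theorem hasSum_gauss_deriv (hc : ∀ m : ℕ, c ≠ -(m : ℂ)) (h : ‖z‖ < 1) :
    HasSum (fun k : ℕ => (k + 1) * gaussCoeff a b c (k + 1) * z ^ k)
      (a * b / c * ordinaryHypergeometric (a + 1) (b + 1) (c + 1) z) := by
  convert! (hasSum_gauss (a + 1) (b + 1) (c + 1) h).mul_left (a * b / c) using 2 with k
  rw [gaussCoeff_succ_shift hc, mul_assoc]

/-- Termwise differentiation on a ball of radius strictly between `‖z‖` and `1`. The derived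
coefficients are multiples of those of the series with all parameters raised by one, whose
summability provides the domination. -/
theorem hasDerivAt_gauss (hc : ∀ m : ℕ, c ≠ -(m : ℂ)) (h : ‖z‖ < 1) :
    HasDerivAt (ordinaryHypergeometric a b c)
      (a * b / c * ordinaryHypergeometric (a + 1) (b + 1) (c + 1) z) z := by
  obtain ⟨r, hzr, hr⟩ := exists_between h
  have hr0 : 0 ≤ r := (norm_nonneg z).trans hzr.le
  have hsum : Summable fun k : ℕ => ‖gaussCoeff a b c k * k‖ * r ^ (k - 1) := by
    rw [← summable_nat_add_iff 1]
    refine ((summable_norm_gaussCoeff (a + 1) (b + 1) (c + 1) hr0 hr).mul_left ‖a * b / c‖).congr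
      fun k => ?_
    rw [← mul_assoc, ← norm_mul, ← gaussCoeff_succ_shift hc, mul_comm (gaussCoeff _ _ _ _)]
    simp
  have key := hasDerivAt_tsum_of_isPreconnected (g := fun k z => gaussCoeff a b c k * z ^ k)
    (g' := fun k z => gaussCoeff a b c k * (k * z ^ (k - 1))) (t := Metric.ball (0 : ℂ) r)
    (y₀ := z) (y := z) hsum Metric.isOpen_ball (convex_ball _ _).isPreconnected
    (fun k w _ => (hasDerivAt_pow k w).const_mul _) (fun k w hw => ?_) (by simpa using hzr)
    (hasSum_gauss a b c h).summable (by simpa using hzr)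
  · have h1 : (fun z : ℂ => ∑' k, gaussCoeff a b c k * z ^ k) = ordinaryHypergeometric a b c := by
      rw [ordinaryHypergeometric_eq_tsum]
      rfl
    rw [h1] at key
    convert! key using 1
    refine (HasSum.tsum_eq ?_).symm
    rw [← hasSum_nat_add_iff' 1]
    simpa [mul_assoc, mul_comm, mul_left_comm] using hasSum_gauss_deriv (a := a) (b := b) hc h
  · rw [← mul_assoc, norm_mul, norm_pow]
    gcongr
    exact (mem_ball_zero_iff.1 hw).le

theorem hasSum_gauss_theta (hc : ∀ m : ℕ, c ≠ -(m : ℂ)) (h : ‖z‖ < 1) :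
    HasSum (fun k : ℕ => k * gaussCoeff a b c k * z ^ k)
      (z * deriv (ordinaryHypergeometric a b c) z) := by
  rw [(hasDerivAt_gauss hc h).deriv, ← hasSum_nat_add_iff' 1]
  simp only [Finset.range_one, Finset.sum_singleton, Nat.cast_zero, zero_mul, sub_zero]
  convert! (hasSum_gauss_deriv hc h).mul_left z using 2 with k
  push_cast
  ring

/-- Raising `c` multiplies the `k`-th coefficient by `c/(c+k)`, and `k · c/(c+k) = c (1 - c/(c+k))`.
With `gauss_deriv_right` this forms the system that governs everything below. -/
theorem gauss_theta_right (hc : ∀ m : ℕ, c ≠ -(m : ℂ)) (h : ‖z‖ < 1) :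
    z * deriv (ordinaryHypergeometric a b (c + 1)) z =
      c * (ordinaryHypergeometric a b c z - ordinaryHypergeometric a b (c + 1) z) := by
  refine (hasSum_gauss_theta (not_neg_nat_add_one hc) h).unique ?_
  convert! ((hasSum_gauss a b c h).sub (hasSum_gauss a b (c + 1) h)).mul_left c using 2 with k
  rw [gaussCoeff_add_one_right hc]
  have := add_nat_ne_zero hc k
  field_simp
  ring

/-- After the coefficient recursion this is the identity `(a+k)(b+k) - k(c+k) = (c-a)(c-b) +
(a+b-c)(c+k)`. -/
theorem gauss_deriv_right (hc : ∀ m : ℕ, c ≠ -(m : ℂ)) (h : ‖z‖ < 1) :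
    c * (1 - z) * deriv (ordinaryHypergeometric a b c) z =
      (c - a) * (c - b) * ordinaryHypergeometric a b (c + 1) z +
        c * (a + b - c) * ordinaryHypergeometric a b c z := by
  have h1 := (hasSum_gauss_deriv (a := a) (b := b) hc h)
  rw [← (hasDerivAt_gauss hc h).deriv] at h1
  have h2 := (h1.sub (hasSum_gauss_theta (a := a) (b := b) hc h)).mul_left c
  have h3 := ((hasSum_gauss a b (c + 1) h).mul_left ((c - a) * (c - b))).add
    ((hasSum_gauss a b c h).mul_left (c * (a + b - c)))
  rw [show c * (1 - z) * deriv (ordinaryHypergeometric a b c) z =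
    c * (deriv (ordinaryHypergeometric a b c) z - z * deriv (ordinaryHypergeometric a b c) z) by
      ring]
  refine h2.unique ?_
  convert! h3 using 2 with k
  rw [gaussCoeff_add_one_right hc, gaussCoeff_succ hc]
  have := add_nat_ne_zero hc k
  field_simp
  ring

theorem gauss_add_one_middle (hc : ∀ m : ℕ, c ≠ -(m : ℂ)) (h : ‖z‖ < 1) :
    ordinaryHypergeometric a b c z = ordinaryHypergeometric a (b + 1) c z -
      a / c * z * ordinaryHypergeometric (a + 1) (b + 1) (c + 1) z := by
  have h1 := (hasSum_gauss a (b + 1) c h).sub (hasSum_gauss a b c h)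
  rw [← hasSum_nat_add_iff' 1] at h1
  simp only [Finset.range_one, Finset.sum_singleton, pow_zero, gaussCoeff_zero, sub_self,
    sub_zero] at h1
  have h2 := h1.unique (a₂ := a / c * z * ordinaryHypergeometric (a + 1) (b + 1) (c + 1) z) (by
    convert! (hasSum_gauss (a + 1) (b + 1) (c + 1) h).mul_left (a / c * z) using 2 with k
    rw [← sub_mul, gaussCoeff_add_one_middle hc]
    ring)
  linear_combination -h2

/-- This is the hypergeometric equation with `F'` expressed through the shifted function and the
common factor `ab/c` cancelled, so it also holds when `ab = 0`. It serves to differentiate the right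
side of Euler's transformation. -/
theorem gauss_deriv_shift (hc : ∀ m : ℕ, c ≠ -(m : ℂ)) (h : ‖z‖ < 1) :
    z * (1 - z) * deriv (ordinaryHypergeometric (a + 1) (b + 1) (c + 1)) z +
      (c - (a + b + 1) * z) * ordinaryHypergeometric (a + 1) (b + 1) (c + 1) z =
      c * ordinaryHypergeometric a b c z := by
  have hc' := not_neg_nat_add_one hc
  have h1 := ((hasSum_gauss_theta (a := a + 1) (b := b + 1) hc' h).add
    ((hasSum_gauss (a + 1) (b + 1) (c + 1) h).mul_left c)).sub ((hasSum_gauss a b c h).mul_left c)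
  rw [← hasSum_nat_add_iff' 1] at h1
  have h2 := h1.unique (a₂ := z * (z * deriv (ordinaryHypergeometric (a + 1) (b + 1) (c + 1)) z +
      (a + b + 1) * ordinaryHypergeometric (a + 1) (b + 1) (c + 1) z)) (by
    convert! ((hasSum_gauss_theta (a := a + 1) (b := b + 1) hc' h).add
      ((hasSum_gauss (a + 1) (b + 1) (c + 1) h).mul_left (a + b + 1))).mul_left z using 2 with k
    have h4 : (k + 1 : ℂ) ≠ 0 := by exact_mod_cast k.succ_ne_zero
    have h5 := add_nat_ne_zero hc' k
    have h6 := ne_zero_of_not_neg_nat hc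
    have h7 := gaussCoeff_succ (a := a + 1) (b := b + 1) hc' k
    have h8 := gaussCoeff_succ_shift (a := a) (b := b) hc k
    rw [mul_comm, ← eq_div_iff h4] at h7 h8
    rw [h7, h8]
    push_cast
    field_simp
    ring)
  simp only [Finset.range_one, Finset.sum_singleton, pow_zero, gaussCoeff_zero] at h2
  linear_combination h2

end Disk

/-! ### Euler's integral and continuation for `0 < Re b < Re c` -/

section EulerIntegral

open Complex MeasureTheory

variable {a b c z : ℂ}

theorem isOpen_cutPlane : IsOpen cutPlane :=
  isOpen_slitPlane.preimage (by fun_prop : Continuous fun z : ℂ => 1 - z)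

theorem one_sub_mul_mem_slitPlane (hz : z ∈ cutPlane) {t : ℝ} (ht : t ∈ Set.Icc (0 : ℝ) 1) :
    1 - t * z ∈ slitPlane := by
  have h := starConvex_one_slitPlane hz (sub_nonneg.2 ht.2) ht.1 (by ring)
  convert! h using 1
  simp
  ring

theorem ball_subset_cutPlane : Metric.ball (0 : ℂ) 1 ⊆ cutPlane := by
  intro z hz
  refine Or.inl ?_
  have h1 : z.re < 1 := (re_le_norm z).trans_lt (mem_ball_zero_iff.1 hz)
  simpa using h1

theorem mem_cutPlane_of_norm_lt_one (h : ‖z‖ < 1) : z ∈ cutPlane :=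
  ball_subset_cutPlane (mem_ball_zero_iff.2 h)

/-- The weight of Euler's integral. -/
noncomputable def eulerWeight (b c : ℂ) (t : ℝ) : ℂ := (t : ℂ) ^ (b - 1) * (1 - (t : ℂ)) ^ (c - b - 1)

/-- Euler's integral `∫₀¹ t^(b-1) (1-t)^(c-b-1) (1-tz)^(-a) dt`. -/
noncomputable def eulerIntegral (a b c z : ℂ) : ℂ :=
  ∫ t : ℝ in 0..1, eulerWeight b c t * (1 - t * z) ^ (-a)

theorem intervalIntegrable_eulerWeight (hb : 0 < b.re) (hcb : 0 < (c - b).re) :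
    IntervalIntegrable (eulerWeight b c) volume 0 1 :=
  betaIntegral_convergent hb hcb

theorem continuousOn_one_sub_mul_cpow (s : ℂ) (hz : z ∈ cutPlane) :
    ContinuousOn (fun t : ℝ => (1 - t * z) ^ s) (Set.uIcc 0 1) := by
  rw [Set.uIcc_of_le zero_le_one]
  exact fun t ht => ContinuousAt.continuousWithinAt
    (ContinuousAt.cpow (by fun_prop) (by fun_prop) (one_sub_mul_mem_slitPlane hz ht))

theorem exists_bound_one_sub_mul_cpow (s : ℂ) {K : Set ℂ} (hK : IsCompact K) (hKc : K ⊆ cutPlane) :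
    ∃ M : ℝ, 0 ≤ M ∧ ∀ z ∈ K, ∀ t ∈ Set.Icc (0 : ℝ) 1, ‖(1 - t * z) ^ s‖ ≤ M := by
  obtain ⟨M, hM⟩ := (hK.prod (isCompact_Icc (a := (0 : ℝ)) (b := 1))).exists_bound_of_continuousOn
    (f := fun p : ℂ × ℝ => (1 - p.2 * p.1) ^ s) (fun p hp => ContinuousAt.continuousWithinAt
      (ContinuousAt.cpow (by fun_prop) (by fun_prop) (one_sub_mul_mem_slitPlane (hKc hp.1) hp.2)))
  exact ⟨max M 0, le_max_right _ _, fun z hz t ht => (hM (z, t) ⟨hz, ht⟩).trans (le_max_left _ _)⟩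

/-- Differentiation under the integral sign: on a compact neighbourhood of `z₀` the `z`-derivative
of the integrand is at most a constant times the integrable weight. -/
theorem differentiableOn_eulerIntegral (a : ℂ) (hb : 0 < b.re) (hcb : 0 < (c - b).re) :
    DifferentiableOn ℂ (eulerIntegral a b c) cutPlane := by
  intro z₀ hz₀
  obtain ⟨K, hK, hKz, hKc⟩ := exists_compact_subset isOpen_cutPlane hz₀
  obtain ⟨M, hM0, hM⟩ := exists_bound_one_sub_mul_cpow (-a - 1) hK hKc
  have hw := intervalIntegrable_eulerWeight hb hcb
  have hint : ∀ z ∈ cutPlane, ∀ s : ℂ,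
      IntervalIntegrable (fun t : ℝ => eulerWeight b c t * (1 - t * z) ^ s) volume 0 1 :=
    fun z hz s => hw.mul_continuousOn (continuousOn_one_sub_mul_cpow s hz)
  have key := intervalIntegral.hasDerivAt_integral_of_dominated_loc_of_deriv_le (μ := volume)
    (F := fun z (t : ℝ) => eulerWeight b c t * (1 - t * z) ^ (-a))
    (F' := fun z (t : ℝ) => eulerWeight b c t * (1 - t * z) ^ (-a - 1) * (a * t))
    (x₀ := z₀) (s := K) (a := 0) (b := 1) (bound := fun t => ‖eulerWeight b c t‖ * (M * ‖a‖))
    (mem_interior_iff_mem_nhds.1 hKz) ?_ (hint z₀ hz₀ _) ?_ ?_ (hw.norm.mul_const _) ?_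
  · exact key.2.differentiableAt.differentiableWithinAt
  · filter_upwards [isOpen_cutPlane.mem_nhds hz₀] with z hz
    exact (hint z hz _).def'.1
  · exact ((hint z₀ hz₀ (-a - 1)).mul_continuousOn
      (by fun_prop : ContinuousOn (fun t : ℝ => a * (t : ℂ)) _)).def'.1
  · refine Eventually.of_forall fun t ht z hz => ?_
    rw [Set.uIoc_of_le zero_le_one] at ht
    rw [mul_assoc, norm_mul, norm_mul, norm_mul a]
    have h1 : ‖(t : ℂ)‖ ≤ 1 := by simpa [abs_of_pos ht.1] using ht.2
    have h2 := hM z hz t ⟨ht.1.le, ht.2⟩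
    have h3 : ‖a‖ * ‖(t : ℂ)‖ ≤ ‖a‖ := mul_le_of_le_one_right (norm_nonneg _) h1
    gcongr
  · refine Eventually.of_forall fun t ht z hz => ?_
    rw [Set.uIoc_of_le zero_le_one] at ht
    have h1 : HasDerivAt (fun z : ℂ => 1 - t * z) (-t) z := by
      simpa using ((hasDerivAt_id z).const_mul (t : ℂ)).const_sub 1
    have h2 := (h1.cpow_const (c := -a)
      (one_sub_mul_mem_slitPlane (hKc hz) ⟨ht.1.le, ht.2⟩)).const_mul (eulerWeight b c t)
    convert! h2 using 1
    ring

/-- The binomial series is `₂F₁(a, 1; 1; z)`, the equal parameters cancelling. -/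
theorem hasSum_one_sub_cpow (a : ℂ) (h : ‖z‖ < 1) :
    HasSum (fun k => gaussCoeff a 1 1 k * z ^ k) ((1 - z) ^ (-a)) := by
  have h1 := (one_add_cpow_hasFPowerSeriesOnBall_zero (a := -a)).hasSum (y := -z) (by
    have : ‖z‖ₑ < 1 := by
      rw [← ofReal_norm]
      exact ENNReal.ofReal_lt_one.2 h
    simpa using this)
  rw [binomialSeries_eq_ordinaryHypergeometricSeries (b := 1) (fun k hk => by
    have : (k : ℂ) + 1 ≠ 0 := by exact_mod_cast k.succ_ne_zero
    exact this (by rw [hk]; ring))] at h1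
  rw [zero_add, ← sub_eq_add_neg, neg_neg] at h1
  convert! h1 using 2 with k
  have h2 := ordinaryHypergeometricSeries_apply_eq (𝔸 := ℂ) a 1 1 z k
  rw [smul_eq_mul] at h2
  rw [gaussCoeff, ← h2, FormalMultilinearSeries.compContinuousLinearMap_apply]
  congr 1
  funext i
  simp

theorem Gamma_add_nat (hc : ∀ m : ℕ, c ≠ -(m : ℂ)) (k : ℕ) :
    Gamma (c + k) = (ascPochhammer ℂ k).eval c * Gamma c := by
  induction k with
  | zero => simp
  | succ k ih =>
    rw [Nat.cast_succ, ← add_assoc, Gamma_add_one _ (add_nat_ne_zero hc k), ih,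
      ascPochhammer_succ_eval]
    ring

theorem not_neg_nat_of_re_pos (hc : 0 < c.re) : ∀ m : ℕ, c ≠ -(m : ℂ) := by
  rintro m rfl
  simp at hc
  linarith [(Nat.cast_nonneg m : (0 : ℝ) ≤ m)]

theorem betaIntegral_ne_zero (hb : 0 < b.re) (hc : 0 < c.re) : betaIntegral b c ≠ 0 := by
  rw [betaIntegral_eq_Gamma_mul_div _ _ hb hc]
  exact div_ne_zero (mul_ne_zero (Gamma_ne_zero_of_re_pos hb) (Gamma_ne_zero_of_re_pos hc))
    (Gamma_ne_zero_of_re_pos (by simpa using add_pos hb hc))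

/-- `betaIntegral (b + k) (c - b)` is the `k`-th moment of Euler's weight; divided by the zeroth
moment it is `(b)ₖ/(c)ₖ`. -/
theorem gaussCoeff_mul_betaIntegral (hb : 0 < b.re) (hcb : 0 < (c - b).re) (k : ℕ) :
    gaussCoeff a 1 1 k * betaIntegral (b + k) (c - b) =
      gaussCoeff a b c k * betaIntegral b (c - b) := by
  have hc : 0 < c.re := by
    have : (c - b).re = c.re - b.re := by simp
    linarith
  have hbk : 0 < (b + k).re := by
    simp
    positivity
  rw [betaIntegral_eq_Gamma_mul_div _ _ hb hcb, betaIntegral_eq_Gamma_mul_div _ _ hbk hcb,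
    show b + k + (c - b) = c + k by ring, show b + (c - b) = c by ring,
    Gamma_add_nat (not_neg_nat_of_re_pos hb), Gamma_add_nat (not_neg_nat_of_re_pos hc)]
  have h1 := Gamma_ne_zero_of_re_pos hc
  have h2 := ascPochhammer_eval_ne_zero (not_neg_nat_of_re_pos hc) k
  have h3 := ascPochhammer_eval_ne_zero (c := 1) (not_neg_nat_of_re_pos (by simp)) k
  have h4 : (k.factorial : ℂ) ≠ 0 := by exact_mod_cast k.factorial_ne_zero
  simp only [gaussCoeff, ordinaryHypergeometricCoefficient]
  field_simp

theorem eulerIntegral_eq (a : ℂ) (hb : 0 < b.re) (hcb : 0 < (c - b).re) (h : ‖z‖ < 1) :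
    eulerIntegral a b c z = betaIntegral b (c - b) * ordinaryHypergeometric a b c z := by
  have hw := intervalIntegrable_eulerWeight hb hcb
  have key := intervalIntegral.hasSum_integral_of_dominated_convergence (μ := volume)
    (a := 0) (b := 1)
    (F := fun k (t : ℝ) => eulerWeight b c t * (gaussCoeff a 1 1 k * (t * z) ^ k))
    (f := fun t : ℝ => eulerWeight b c t * (1 - t * z) ^ (-a))
    (fun k t => ‖eulerWeight b c t‖ * (‖gaussCoeff a 1 1 k‖ * ‖z‖ ^ k)) ?_ ?_ ?_ ?_ ?_
  · refine key.unique ?_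
    convert! (hasSum_gauss a b c h).mul_left (betaIntegral b (c - b)) using 2 with k
    rw [← mul_assoc, mul_comm (betaIntegral _ _), ← gaussCoeff_mul_betaIntegral hb hcb,
      betaIntegral, mul_comm (gaussCoeff _ _ _ _), mul_assoc,
      ← intervalIntegral.integral_mul_const]
    refine intervalIntegral.integral_congr_ae (Eventually.of_forall fun t ht => ?_)
    rw [Set.uIoc_of_le zero_le_one] at ht
    have ht0 : (t : ℂ) ≠ 0 := by exact_mod_cast ht.1.ne'
    rw [eulerWeight, show b + k - 1 = b - 1 + k by ring, cpow_add _ _ ht0, cpow_natCast]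
    ring
  · intro k
    exact (hw.mul_continuousOn (by fun_prop)).def'.1
  · refine fun k => Eventually.of_forall fun t ht => ?_
    rw [Set.uIoc_of_le zero_le_one] at ht
    have h1 : ‖(t : ℂ) * z‖ ≤ ‖z‖ := by
      rw [norm_mul]
      exact mul_le_of_le_one_left (norm_nonneg _) (by simpa [abs_of_pos ht.1] using ht.2)
    rw [norm_mul, norm_mul, norm_pow]
    gcongr
  · exact Eventually.of_forall fun t _ =>
      (summable_norm_gaussCoeff a 1 1 (norm_nonneg z) h).mul_left _
  · simp_rw [tsum_mul_left]
    exact hw.norm.mul_const _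
  · refine Eventually.of_forall fun t ht => ?_
    rw [Set.uIoc_of_le zero_le_one] at ht
    have h1 : ‖(t : ℂ) * z‖ < 1 := by
      rw [norm_mul]
      exact (mul_le_of_le_one_left (norm_nonneg _)
        (by simpa [abs_of_pos ht.1] using ht.2)).trans_lt h
    exact (hasSum_one_sub_cpow a h1).mul_left _

theorem isGaussContinuation_eulerIntegral (a : ℂ) (hb : 0 < b.re) (hcb : 0 < (c - b).re) :
    IsGaussContinuation a b c fun z => (betaIntegral b (c - b))⁻¹ * eulerIntegral a b c z := by
  refine ⟨(differentiableOn_eulerIntegral a hb hcb).const_mul _, fun z hz => ?_⟩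
  simp only
  rw [eulerIntegral_eq a hb hcb hz, inv_mul_cancel_left₀ (betaIntegral_ne_zero hb hcb)]

end EulerIntegral

/-! ### Continuation for all parameters; identities on the cut plane -/

section Continuation

open Complex

variable {a b c z : ℂ}

/-- The derivative of `F(c+1)` is eliminated between `gauss_theta_right` at `c` and
`gauss_deriv_right` at `c + 1`. -/
theorem gauss_three_term (hc : ∀ m : ℕ, c ≠ -(m : ℂ)) (h : ‖z‖ < 1) :
    (c + 1) * c * (z - 1) * ordinaryHypergeometric a b c z +
      B13 a b (c + 1) z * ordinaryHypergeometric a b (c + 1) z +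
      C13 a b (c + 1) z * ordinaryHypergeometric a b (c + 1 + 1) z = 0 := by
  have h1 := gauss_theta_right (a := a) (b := b) hc h
  have h2 := gauss_deriv_right (a := a) (b := b) (not_neg_nat_add_one hc) h
  simp only [B13, C13]
  linear_combination (c + 1) * (1 - z) * h1 - z * h2

/-- Each use of `gauss_add_one_middle` replaces `b` by `b + 1`. In one of the two terms this costs
one unit of `Re (c - b)`, hence the room `m` required there. -/
theorem exists_isGaussContinuation_of_re (m : ℕ) : ∀ a b c : ℂ, -(m : ℝ) < b.re →
    (m : ℝ) < (c - b).re → 0 < c.re → ∃ F, IsGaussContinuation a b c F := by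
  induction m with
  | zero =>
    intro a b c hb hcb _
    exact ⟨_, isGaussContinuation_eulerIntegral a (by simpa using hb) (by simpa using hcb)⟩
  | succ m ih =>
    intro a b c hb hcb hc
    push_cast at hb hcb
    simp only [sub_re] at hcb
    obtain ⟨F, hF, hF'⟩ := ih a (b + 1) c (by simp; linarith) (by simp; linarith) hc
    obtain ⟨G, hG, hG'⟩ := ih (a + 1) (b + 1) (c + 1) (by simp; linarith) (by simp; linarith)
      (by simp; linarith)
    refine ⟨fun z => F z - a / c * z * G z, hF.sub (DifferentiableOn.mul (by fun_prop) hG),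
      fun z hz => ?_⟩
    simp only
    rw [hF' z hz, hG' z hz, gauss_add_one_middle (a := a) (b := b) (not_neg_nat_of_re_pos hc) hz]

theorem one_sub_ne_zero_of_mem_cutPlane (hz : z ∈ cutPlane) : 1 - z ≠ 0 :=
  slitPlane_ne_zero hz

/-- The recurrence is run backwards in `c`: the coefficient of `F(c)` is `(c+1) c (z-1)`, which has
no zero on the cut plane. -/
theorem exists_isGaussContinuation_of_add_nat (a b : ℂ) (m : ℕ) : ∀ c : ℂ,
    (∀ k : ℕ, c ≠ -(k : ℂ)) → (∃ F, IsGaussContinuation a b (c + m) F) →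
    (∃ F, IsGaussContinuation a b (c + m + 1) F) → ∃ F, IsGaussContinuation a b c F := by
  induction m with
  | zero =>
    intro c _ h _
    simpa using h
  | succ m ih =>
    intro c hc h1 h2
    have e : c + (m + 1 : ℕ) = c + m + 1 := by push_cast; ring
    rw [e] at h1 h2
    refine ih c hc ?_ h1
    obtain ⟨F, hF, hF'⟩ := h1
    obtain ⟨G, hG, hG'⟩ := h2
    have hcm := not_neg_nat_add hc m
    have h3 := ne_zero_of_not_neg_nat hcm
    have h4 := ne_zero_of_not_neg_nat (not_neg_nat_add_one hcm)
    refine ⟨fun z => (B13 a b (c + m + 1) z * F z + C13 a b (c + m + 1) z * G z) /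
      ((c + m + 1) * (c + m) * (1 - z)), ?_, fun z hz => ?_⟩
    · refine DifferentiableOn.div (.add (.mul ?_ hF) (.mul ?_ hG)) (by fun_prop) fun z hz =>
        mul_ne_zero (mul_ne_zero h4 h3) (one_sub_ne_zero_of_mem_cutPlane hz)
      · unfold B13; fun_prop
      · unfold C13; fun_prop
    · have h5 := one_sub_ne_zero_of_mem_cutPlane (mem_cutPlane_of_norm_lt_one hz)
      have h6 := gauss_three_term (a := a) (b := b) hcm hz
      simp only
      rw [hF' z hz, hG' z hz, div_eq_iff (mul_ne_zero (mul_ne_zero h4 h3) h5)]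
      linear_combination h6

theorem exists_isGaussContinuation (a b : ℂ) (hc : ∀ m : ℕ, c ≠ -(m : ℂ)) :
    ∃ F, IsGaussContinuation a b c F := by
  -- `k` is the number of steps by which `b` must be raised; `m` moves `c` far enough right to leave
  -- room for them.
  obtain ⟨k, hk⟩ := exists_nat_gt (-b.re)
  obtain ⟨m, hm⟩ := exists_nat_gt (max (k + b.re - c.re) (-c.re))
  have hm1 := (le_max_left _ _).trans_lt hm
  have hm2 := (le_max_right _ _).trans_lt hm
  refine exists_isGaussContinuation_of_add_nat a b m c hc ?_ ?_ <;>
    refine exists_isGaussContinuation_of_re k _ _ _ ?_ ?_ ?_ <;>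
    (try simp only [sub_re, add_re, natCast_re, one_re]) <;> linarith

theorem isGaussContinuation_gaussPrincipal (a b : ℂ) (hc : ∀ m : ℕ, c ≠ -(m : ℂ)) :
    IsGaussContinuation a b c (gaussPrincipal a b c) :=
  Classical.epsilon_spec (exists_isGaussContinuation a b hc)

theorem isPreconnected_cutPlane : IsPreconnected cutPlane := by
  have h : StarConvex ℝ 0 cutPlane := by
    intro z hz s t hs ht hst
    simpa [cutPlane] using one_sub_mul_mem_slitPlane hz (t := t) ⟨ht, by linarith⟩
  exact h.isPathConnected (mem_cutPlane_of_norm_lt_one (by simp)) |>.isConnected.isPreconnected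

/-- Two holomorphic functions on the cut plane that agree on the unit disk are equal. -/
theorem eqOn_cutPlane {F G : ℂ → ℂ} (hF : DifferentiableOn ℂ F cutPlane)
    (hG : DifferentiableOn ℂ G cutPlane) (h : ∀ z : ℂ, ‖z‖ < 1 → F z = G z) :
    Set.EqOn F G cutPlane := by
  refine (hF.analyticOnNhd isOpen_cutPlane).eqOn_of_preconnected_of_eventuallyEq
    (hG.analyticOnNhd isOpen_cutPlane) isPreconnected_cutPlane
    (mem_cutPlane_of_norm_lt_one (z := 0) (by simp)) ?_
  filter_upwards [Metric.ball_mem_nhds (0 : ℂ) one_pos] with z hz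
  exact h z (mem_ball_zero_iff.1 hz)

theorem IsGaussContinuation.eqOn {F G : ℂ → ℂ} (hF : IsGaussContinuation a b c F)
    (hG : IsGaussContinuation a b c G) : Set.EqOn F G cutPlane :=
  eqOn_cutPlane hF.1 hG.1 fun z hz => (hF.2 z hz).trans (hG.2 z hz).symm

theorem differentiableOn_gaussPrincipal (a b : ℂ) (hc : ∀ m : ℕ, c ≠ -(m : ℂ)) :
    DifferentiableOn ℂ (gaussPrincipal a b c) cutPlane :=
  (isGaussContinuation_gaussPrincipal a b hc).1

theorem differentiableAt_gaussPrincipal (a b : ℂ) (hc : ∀ m : ℕ, c ≠ -(m : ℂ))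
    (hz : z ∈ cutPlane) : DifferentiableAt ℂ (gaussPrincipal a b c) z :=
  (differentiableOn_gaussPrincipal a b hc).differentiableAt (isOpen_cutPlane.mem_nhds hz)

theorem gaussPrincipal_eq (a b : ℂ) (hc : ∀ m : ℕ, c ≠ -(m : ℂ)) (h : ‖z‖ < 1) :
    gaussPrincipal a b c z = ordinaryHypergeometric a b c z :=
  (isGaussContinuation_gaussPrincipal a b hc).2 z h

theorem deriv_gaussPrincipal_eq (a b : ℂ) (hc : ∀ m : ℕ, c ≠ -(m : ℂ)) (h : ‖z‖ < 1) :
    deriv (gaussPrincipal a b c) z = deriv (ordinaryHypergeometric a b c) z := by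
  refine Filter.EventuallyEq.deriv_eq ?_
  filter_upwards [Metric.isOpen_ball.mem_nhds (mem_ball_zero_iff.2 h)] with w hw
  exact gaussPrincipal_eq a b hc (mem_ball_zero_iff.1 hw)

/-- Here and in the next relations both sides are holomorphic on the cut plane, so the identity in
the disk propagates. -/
theorem gaussPrincipal_add_one_middle (hc : ∀ m : ℕ, c ≠ -(m : ℂ)) (hz : z ∈ cutPlane) :
    gaussPrincipal a b c z = gaussPrincipal a (b + 1) c z -
      a / c * z * gaussPrincipal (a + 1) (b + 1) (c + 1) z := by
  have hc' := not_neg_nat_add_one hc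
  refine eqOn_cutPlane (F := gaussPrincipal a b c) (G := fun z => gaussPrincipal a (b + 1) c z -
      a / c * z * gaussPrincipal (a + 1) (b + 1) (c + 1) z)
    (differentiableOn_gaussPrincipal a b hc)
    ((differentiableOn_gaussPrincipal a (b + 1) hc).sub
      (.mul (by fun_prop) (differentiableOn_gaussPrincipal (a + 1) (b + 1) hc'))) (fun w hw => ?_) hz
  rw [gaussPrincipal_eq a b hc hw, gaussPrincipal_eq _ _ hc hw, gaussPrincipal_eq _ _ hc' hw,
    gauss_add_one_middle hc hw]

theorem gaussPrincipal_theta_right (hc : ∀ m : ℕ, c ≠ -(m : ℂ)) (hz : z ∈ cutPlane) :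
    z * deriv (gaussPrincipal a b (c + 1)) z =
      c * (gaussPrincipal a b c z - gaussPrincipal a b (c + 1) z) := by
  have hc' := not_neg_nat_add_one hc
  have h1 := differentiableOn_gaussPrincipal a b hc
  have h2 := differentiableOn_gaussPrincipal a b hc'
  refine eqOn_cutPlane (F := fun z => z * deriv (gaussPrincipal a b (c + 1)) z)
    (G := fun z => c * (gaussPrincipal a b c z - gaussPrincipal a b (c + 1) z))
    (.mul (by fun_prop) (h2.deriv isOpen_cutPlane)) ((h1.sub h2).const_mul c) (fun w hw => ?_) hz
  rw [deriv_gaussPrincipal_eq a b hc' hw, gaussPrincipal_eq a b hc hw,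
    gaussPrincipal_eq a b hc' hw, gauss_theta_right hc hw]

theorem gaussPrincipal_deriv_right (hc : ∀ m : ℕ, c ≠ -(m : ℂ)) (hz : z ∈ cutPlane) :
    c * (1 - z) * deriv (gaussPrincipal a b c) z =
      (c - a) * (c - b) * gaussPrincipal a b (c + 1) z +
        c * (a + b - c) * gaussPrincipal a b c z := by
  have hc' := not_neg_nat_add_one hc
  have h1 := differentiableOn_gaussPrincipal a b hc
  have h2 := differentiableOn_gaussPrincipal a b hc'
  refine eqOn_cutPlane (F := fun z => c * (1 - z) * deriv (gaussPrincipal a b c) z)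
    (G := fun z => (c - a) * (c - b) * gaussPrincipal a b (c + 1) z +
        c * (a + b - c) * gaussPrincipal a b c z)
    (.mul (by fun_prop) (h1.deriv isOpen_cutPlane))
    ((h2.const_mul _).add (h1.const_mul _)) (fun w hw => ?_) hz
  rw [deriv_gaussPrincipal_eq a b hc hw, gaussPrincipal_eq a b hc hw,
    gaussPrincipal_eq a b hc' hw, gauss_deriv_right hc hw]

theorem gaussPrincipal_three_term (hc : ∀ m : ℕ, c ≠ -(m : ℂ)) (hz : z ∈ cutPlane) :
    A13 (c + 1) z * gaussPrincipal a b c z + B13 a b (c + 1) z * gaussPrincipal a b (c + 1) z +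
      C13 a b (c + 1) z * gaussPrincipal a b (c + 1 + 1) z = 0 := by
  have h1 := gaussPrincipal_theta_right (a := a) (b := b) hc hz
  have h2 := gaussPrincipal_deriv_right (a := a) (b := b) (not_neg_nat_add_one hc) hz
  simp only [A13, B13, C13]
  linear_combination (c + 1) * (1 - z) * h1 - z * h2

end Continuation

/-! ### Asymptotics of quotients of Gamma functions -/

section GammaRatio

open Complex

/-- Euler's product approximation is expressed through `Γ(s+n)`; in the quotient for two values of
`s` the factorials cancel and a power of `n` remains. -/
theorem GammaSeq_eq_div_Gamma {s : ℂ} (hs : ∀ m : ℕ, s ≠ -(m : ℂ)) (n : ℕ) :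
    GammaSeq s n = (n : ℂ) ^ s * n.factorial * Gamma s / ((s + n) * Gamma (s + n)) := by
  have h1 : ∏ j ∈ Finset.range (n + 1), (s + j) = (ascPochhammer ℂ (n + 1)).eval s := by
    induction n with
    | zero => simp
    | succ n ih => rw [Finset.prod_range_succ, ih, ascPochhammer_succ_eval (n + 1)]
  have h2 : Gamma (s + n) ≠ 0 := Gamma_ne_zero (not_neg_nat_add hs n)
  have h3 := Gamma_ne_zero hs
  have h4 := add_nat_ne_zero hs n
  have h5 := ascPochhammer_eval_ne_zero hs n
  rw [GammaSeq, h1, ascPochhammer_succ_eval, Gamma_add_nat hs]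
  field_simp

/-- `Γ(u+n) / Γ(v+n) ∼ n^(u-v)`. -/
theorem tendsto_Gamma_div_Gamma_div_cpow {u v : ℂ} (hu : ∀ m : ℕ, u ≠ -(m : ℂ))
    (hv : ∀ m : ℕ, v ≠ -(m : ℂ)) :
    Tendsto (fun n : ℕ => Gamma (u + n) / Gamma (v + n) / (n : ℂ) ^ (u - v)) atTop (𝓝 1) := by
  have h1 := Gamma_ne_zero hu
  have h2 := Gamma_ne_zero hv
  have h3 : Tendsto (fun n : ℕ => (v + (1 : ℂ) * n) / (u + 1 * n)) atTop (𝓝 (1 / 1)) :=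
    tendsto_add_mul_div_add_mul_atTop_nhds _ _ _ one_ne_zero
  have h4 := (h3.mul ((tendsto_const_nhds (x := Gamma u)).div (GammaSeq_tendsto_Gamma u) h1)).mul
    ((GammaSeq_tendsto_Gamma v).div_const (Gamma v))
  rw [div_self h1, div_self h2, div_one, mul_one, mul_one] at h4
  refine h4.congr' ?_
  filter_upwards [eventually_ne_atTop 0] with n hn
  have hn' : (n : ℂ) ≠ 0 := by exact_mod_cast hn
  have h5 : Gamma (u + n) ≠ 0 := Gamma_ne_zero (not_neg_nat_add hu n)
  have h6 : Gamma (v + n) ≠ 0 := Gamma_ne_zero (not_neg_nat_add hv n)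
  have h7 := add_nat_ne_zero hu n
  have h8 := add_nat_ne_zero hv n
  have h9 : (n.factorial : ℂ) ≠ 0 := by exact_mod_cast n.factorial_ne_zero
  have h10 : (n : ℂ) ^ u ≠ 0 := by simp [cpow_eq_zero_iff, hn']
  have h11 : (n : ℂ) ^ v ≠ 0 := by simp [cpow_eq_zero_iff, hn']
  rw [Pi.div_apply, GammaSeq_eq_div_Gamma hu, GammaSeq_eq_div_Gamma hv, cpow_sub _ _ hn']
  simp only [one_mul]
  field_simp

theorem isBigO_Gamma_div_Gamma {u v : ℂ} (hu : ∀ m : ℕ, u ≠ -(m : ℂ))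
    (hv : ∀ m : ℕ, v ≠ -(m : ℂ)) :
    (fun n : ℕ => Gamma (u + n) / Gamma (v + n)) =O[atTop] fun n : ℕ => (n : ℝ) ^ (u - v).re := by
  have h := (tendsto_Gamma_div_Gamma_div_cpow hu hv).isBigO_one ℂ
  have h2 := h.mul (Asymptotics.isBigO_refl (fun n : ℕ => (n : ℂ) ^ (u - v)) atTop)
  refine Asymptotics.IsBigO.congr' (h2.trans (Asymptotics.IsBigO.of_bound 1 ?_)) ?_
    (EventuallyEq.refl _ _)
  · filter_upwards [eventually_gt_atTop 0] with n hn
    rw [one_mul, one_mul, norm_natCast_cpow_of_pos hn, Real.norm_eq_abs]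
    exact le_abs_self _
  · filter_upwards [eventually_ne_atTop 0] with n hn
    have hn' : (n : ℂ) ≠ 0 := by exact_mod_cast hn
    have h10 : (n : ℂ) ^ (u - v) ≠ 0 := by simp [cpow_eq_zero_iff, hn']
    field_simp

/-- The two Gamma quotients have orders `n^(-(Re b + 1))` and `n^(Re b)`. -/
theorem isBigO_betaIntegral_div {b c : ℂ} (hb : 0 < b.re) (hcb : 0 < (c - b).re) :
    (fun n : ℕ => betaIntegral (b.re + 1) ((c - b).re + n) / betaIntegral b (c - b + n)) =O[atTop]
      fun n : ℕ => 1 / (n : ℝ) := by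
  have hc : 0 < c.re := by
    have : (c - b).re = c.re - b.re := by simp
    linarith
  set y := (c - b).re with hy
  have hy' : 0 < (y : ℂ).re := by simpa using hcb
  have hxy : 0 < ((b.re : ℂ) + 1 + y).re := by simp; linarith
  have h1 := isBigO_Gamma_div_Gamma (not_neg_nat_of_re_pos hy') (not_neg_nat_of_re_pos hxy)
  have h2 := isBigO_Gamma_div_Gamma (not_neg_nat_of_re_pos hc) (not_neg_nat_of_re_pos hcb)
  have h3 := (h1.mul h2).const_mul_left (Gamma (b.re + 1) / Gamma b)
  refine h3.congr' ?_ ?_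
  · refine Eventually.of_forall fun n => ?_
    have e1 : 0 < ((b.re : ℂ) + 1).re := by simp; linarith
    have e2 : 0 < ((y : ℂ) + n).re := by simp; positivity
    have e3 : 0 < (c - b + n).re := by rw [add_re, ← hy, natCast_re]; positivity
    simp only
    rw [betaIntegral_eq_Gamma_mul_div _ _ e1 e2, betaIntegral_eq_Gamma_mul_div _ _ hb e3,
      show b + (c - b + n) = c + n by ring, show (b.re : ℂ) + 1 + (y + n) = b.re + 1 + y + n by ring]
    have e4 := Gamma_ne_zero_of_re_pos hb
    have e5 := Gamma_ne_zero_of_re_pos e3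
    have e6 : Gamma (c + n) ≠ 0 := Gamma_ne_zero (not_neg_nat_add (not_neg_nat_of_re_pos hc) n)
    have e7 : Gamma ((b.re : ℂ) + 1 + y + n) ≠ 0 :=
      Gamma_ne_zero (not_neg_nat_add (not_neg_nat_of_re_pos hxy) n)
    field_simp
  · filter_upwards [eventually_gt_atTop 0] with n hn
    have hn' : (0 : ℝ) < n := by exact_mod_cast hn
    rw [← Real.rpow_add hn', one_div, ← Real.rpow_neg_one]
    congr 1
    simp

end GammaRatio

/-! ### Large `c` on compact subsets of the cut plane -/

section Asymptotics

open Complex MeasureTheory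

variable {a b c : ℂ} {K : Set ℂ}

/-- Mean value inequality in `t` on `[0, 1]`, starting from the value `1` at `t = 0`. -/
theorem exists_bound_one_sub_mul_cpow_sub_one (a : ℂ) (hK : IsCompact K) (hKc : K ⊆ cutPlane) :
    ∃ M : ℝ, 0 ≤ M ∧ ∀ z ∈ K, ∀ t ∈ Set.Icc (0 : ℝ) 1, ‖(1 - t * z) ^ (-a) - 1‖ ≤ M * t := by
  obtain ⟨M, hM0, hM⟩ := exists_bound_one_sub_mul_cpow (-a - 1) hK hKc
  obtain ⟨R, hR⟩ := hK.isBounded.exists_norm_le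
  refine ⟨‖a‖ * M * max R 0, by positivity, fun z hz t ht => ?_⟩
  have key := norm_image_sub_le_of_norm_deriv_le_segment' (a := (0 : ℝ)) (b := 1)
    (f := fun s : ℝ => (1 - s * z) ^ (-a)) (f' := fun s : ℝ => -a * (1 - s * z) ^ (-a - 1) * -z)
    (C := ‖a‖ * M * max R 0) (fun s hs => ?_) (fun s hs => ?_) t ht
  · simpa using key
  · have h1 : HasDerivAt (fun s : ℂ => 1 - s * z) (-z) (s : ℂ) := by
      simpa using ((hasDerivAt_id (s : ℂ)).mul_const z).const_sub 1
    exact (h1.cpow_const (one_sub_mul_mem_slitPlane (hKc hz) hs)).comp_ofReal.hasDerivWithinAt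
  · rw [norm_mul, norm_mul, norm_neg, norm_neg]
    have h1 := hM z hz s ⟨hs.1, hs.2.le⟩
    have h2 := (hR z hz).trans (le_max_left R 0)
    gcongr

theorem norm_betaIntegral_ofReal (x y : ℝ) :
    ‖betaIntegral (x + 1) y‖ = ∫ t : ℝ in 0..1, t ^ x * (1 - t) ^ (y - 1) := by
  have h : betaIntegral (x + 1) y = ((∫ t : ℝ in 0..1, t ^ x * (1 - t) ^ (y - 1) : ℝ) : ℂ) := by
    rw [← intervalIntegral.integral_ofReal, betaIntegral]
    refine intervalIntegral.integral_congr fun t ht => ?_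
    rw [Set.uIcc_of_le zero_le_one] at ht
    simp only [add_sub_cancel_right]
    push_cast
    rw [ofReal_cpow ht.1, ofReal_cpow (sub_nonneg.2 ht.2)]
    push_cast
    rfl
  rw [h, norm_real, Real.norm_of_nonneg]
  exact intervalIntegral.integral_nonneg zero_le_one fun t ht =>
    mul_nonneg (Real.rpow_nonneg ht.1 _) (Real.rpow_nonneg (sub_nonneg.2 ht.2) _)

/-- The factor `t` in the bound for `(1 - tz)^(-a) - 1` raises the first Beta parameter by one,
which is what gains `1/n`. -/
theorem norm_eulerIntegral_sub_le (hb : 0 < b.re) (hcb : 1 < (c - b).re) {z : ℂ}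
    (hz : z ∈ cutPlane) {M : ℝ}
    (hM : ∀ t ∈ Set.Icc (0 : ℝ) 1, ‖(1 - t * z) ^ (-a) - 1‖ ≤ M * t) :
    ‖eulerIntegral a b c z - betaIntegral b (c - b)‖ ≤
      M * ‖betaIntegral (b.re + 1) (c - b).re‖ := by
  have hw := intervalIntegrable_eulerWeight hb (zero_lt_one.trans hcb)
  have h1 : eulerIntegral a b c z - betaIntegral b (c - b) =
      ∫ t : ℝ in 0..1, eulerWeight b c t * ((1 - t * z) ^ (-a) - 1) := by
    rw [eulerIntegral, show betaIntegral b (c - b) = ∫ t : ℝ in 0..1, eulerWeight b c t from rfl,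
      ← intervalIntegral.integral_sub
      (hw.mul_continuousOn (continuousOn_one_sub_mul_cpow _ hz)) hw]
    refine intervalIntegral.integral_congr fun t _ => ?_
    simp only [eulerWeight]
    ring
  rw [h1, norm_betaIntegral_ofReal, ← intervalIntegral.integral_const_mul]
  refine intervalIntegral.norm_integral_le_of_norm_le zero_le_one
    (Eventually.of_forall fun t ht => ?_) (Continuous.intervalIntegrable ?_ _ _)
  · have ht' : t ∈ Set.Icc (0 : ℝ) 1 := ⟨ht.1.le, ht.2⟩
    have h2 : ‖eulerWeight b c t‖ * t = t ^ b.re * (1 - t) ^ ((c - b).re - 1) := by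
      have e : (1 - (t : ℂ)) = ((1 - t : ℝ) : ℂ) := by push_cast; rfl
      rw [eulerWeight, norm_mul, norm_cpow_eq_rpow_re_of_pos ht.1, e,
        norm_cpow_eq_rpow_re_of_nonneg (sub_nonneg.2 ht.2) (by
          simp only [sub_re, one_re] at hcb ⊢
          linarith), mul_right_comm]
      congr 1
      nth_rewrite 2 [← Real.rpow_one t]
      rw [← Real.rpow_add ht.1]
      simp
    rw [norm_mul, ← h2]
    calc _ ≤ ‖eulerWeight b c t‖ * (M * t) := by gcongr; exact hM t ht'
      _ = _ := by ring
  · have e1 : Continuous fun t : ℝ => t ^ b.re := continuous_id.rpow_const fun _ => Or.inr hb.le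
    have e2 : Continuous fun t : ℝ => (1 - t) ^ ((c - b).re - 1) :=
      (continuous_const.sub continuous_id).rpow_const fun _ => Or.inr (sub_nonneg.2 hcb.le)
    exact continuous_const.mul (e1.mul e2)

/-- An `O(1/n)` bound that is uniform on a set may be proved for a shifted sequence. -/
theorem exists_bound_div_of_shift {φ : ℕ → ℂ → ℂ} (N : ℕ)
    (h : ∃ M : ℝ, ∀ᶠ n : ℕ in atTop, ∀ z ∈ K, ‖φ (n + N) z‖ ≤ M / n) :
    ∃ M : ℝ, ∀ᶠ n : ℕ in atTop, ∀ z ∈ K, ‖φ n z‖ ≤ M / n := by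
  obtain ⟨M, hM⟩ := h
  obtain ⟨n₀, hn₀⟩ := eventually_atTop.1 hM
  -- With `n = m + N` and `N ≤ m` one has `1/m ≤ 2/n`.
  refine ⟨2 * |M|, eventually_atTop.2 ⟨n₀ + 2 * N + 1, fun n hn z hz => ?_⟩⟩
  obtain ⟨m, rfl⟩ : ∃ m, n = m + N := ⟨n - N, by omega⟩
  have hm : (0 : ℝ) < m := by exact_mod_cast (by omega : 0 < m)
  have hmN : (N : ℝ) ≤ m := by exact_mod_cast (by omega : N ≤ m)
  refine (hn₀ m (by omega) z hz).trans ?_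
  push_cast
  rw [div_le_div_iff₀ hm (by positivity)]
  nlinarith [le_abs_self M, abs_nonneg M]

theorem exists_bound_gaussPrincipal_sub_one_of_re (hb : 0 < b.re) (hc : ∀ m : ℕ, c ≠ -(m : ℂ))
    (hK : IsCompact K) (hKc : K ⊆ cutPlane) :
    ∃ M : ℝ, ∀ᶠ n : ℕ in atTop, ∀ z ∈ K, ‖gaussPrincipal a b (c + n) z - 1‖ ≤ M / n := by
  -- Shifting `c` by `N` gives `Re (c + N - b) > 1`, as the integral estimate needs.
  obtain ⟨N, hN⟩ := exists_nat_gt (1 + b.re - c.re)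
  refine exists_bound_div_of_shift (φ := fun n z => gaussPrincipal a b (c + n) z - 1) N ?_
  obtain ⟨M, hM0, hM⟩ := exists_bound_one_sub_mul_cpow_sub_one a hK hKc
  have hre : 1 < (c + N - b).re := by simp; linarith
  obtain ⟨C, hC⟩ := (isBigO_betaIntegral_div hb (zero_lt_one.trans hre)).bound
  refine ⟨M * C, hC.mono fun n hn z hz => ?_⟩
  have e : c + (n + N : ℕ) - b = c + N - b + n := by push_cast; ring
  have hren : 1 < (c + (n + N : ℕ) - b).re := by
    rw [e, add_re, natCast_re]
    linarith [(Nat.cast_nonneg n : (0 : ℝ) ≤ n)]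
  have h1 := norm_eulerIntegral_sub_le (a := a) hb hren (hKc hz) (hM z hz)
  have hB : betaIntegral b (c + (n + N : ℕ) - b) ≠ 0 :=
    betaIntegral_ne_zero hb (zero_lt_one.trans hren)
  have h2 := ((isGaussContinuation_gaussPrincipal a b (not_neg_nat_add hc (n + N))).eqOn
    (isGaussContinuation_eulerIntegral a hb (zero_lt_one.trans hren))) (hKc hz)
  have h3 : gaussPrincipal a b (c + (n + N : ℕ)) z - 1 =
      (eulerIntegral a b (c + (n + N : ℕ)) z - betaIntegral b (c + (n + N : ℕ) - b)) /
        betaIntegral b (c + (n + N : ℕ) - b) := by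
    rw [h2]
    field_simp
  rw [h3, norm_div, div_le_iff₀ (norm_pos_iff.2 hB)]
  refine h1.trans ?_
  rw [norm_div, div_le_iff₀ (norm_pos_iff.2 (by rw [← e]; exact hB)), ← e] at hn
  rw [e, add_re, natCast_re, ofReal_add, ofReal_natCast, ← e]
  refine (mul_le_mul_of_nonneg_left hn hM0).trans (le_of_eq ?_)
  simp
  ring

/-- Lowering `b` by one adds a term with the factor `a/(c+n)`, itself `O(1/n)` because the function
beside it is bounded. -/
theorem exists_bound_gaussPrincipal_sub_one_of_neg (hK : IsCompact K) (hKc : K ⊆ cutPlane)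
    (m : ℕ) : ∀ a b c : ℂ, -(m : ℝ) < b.re → (∀ m : ℕ, c ≠ -(m : ℂ)) →
    ∃ M : ℝ, ∀ᶠ n : ℕ in atTop, ∀ z ∈ K, ‖gaussPrincipal a b (c + n) z - 1‖ ≤ M / n := by
  induction m with
  | zero => exact fun a b c hb hc =>
      exists_bound_gaussPrincipal_sub_one_of_re (by simpa using hb) hc hK hKc
  | succ m ih =>
    intro a b c hb hc
    push_cast at hb
    have hb' : -(m : ℝ) < (b + 1).re := by simp; linarith
    obtain ⟨M₁, h₁⟩ := ih a (b + 1) c hb' hc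
    obtain ⟨M₂, h₂⟩ := ih (a + 1) (b + 1) (c + 1) hb' (not_neg_nat_add_one hc)
    obtain ⟨R, hR⟩ := hK.isBounded.exists_norm_le
    -- For `n ≥ N` this yields `‖c + n‖ ≥ n/2`.
    obtain ⟨N, hN⟩ := exists_nat_gt (2 * ‖c‖)
    refine ⟨M₁ + 2 * ‖a‖ * max R 0 * (|M₂| + 1), ?_⟩
    filter_upwards [h₁, h₂, eventually_ge_atTop N, eventually_ge_atTop 1] with n h1 h2 hnN hn1 z hz
    have hn : (1 : ℝ) ≤ n := by exact_mod_cast hn1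
    have hn0 : (0 : ℝ) < n := by linarith
    have e : c + n + 1 = c + 1 + n := by ring
    rw [gaussPrincipal_add_one_middle (not_neg_nat_add hc n) (hKc hz), e]
    have h3 : ‖gaussPrincipal (a + 1) (b + 1) (c + 1 + n) z‖ ≤ |M₂| + 1 := by
      have e1 := norm_le_norm_sub_add (gaussPrincipal (a + 1) (b + 1) (c + 1 + n) z) 1
      have e2 : M₂ / n ≤ |M₂| := (div_le_div_of_nonneg_right (le_abs_self _) hn0.le).trans
        (div_le_self (abs_nonneg _) hn)
      have := h2 z hz
      rw [norm_one] at e1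
      linarith
    have h4 : (n : ℝ) / 2 ≤ ‖c + n‖ := by
      have e1 : ‖(n : ℂ)‖ ≤ ‖c + n‖ + ‖c‖ := by
        calc ‖(n : ℂ)‖ = ‖c + n - c‖ := by ring_nf
          _ ≤ _ := norm_sub_le _ _
      rw [norm_natCast] at e1
      have : (N : ℝ) ≤ n := by exact_mod_cast hnN
      linarith
    have h5 : ‖a / (c + n) * z‖ ≤ 2 * ‖a‖ * max R 0 / n := by
      rw [norm_mul, norm_div]
      have := (hR z hz).trans (le_max_left R 0)
      calc ‖a‖ / ‖c + n‖ * ‖z‖ ≤ ‖a‖ / (n / 2) * max R 0 := by gcongr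
        _ = _ := by field_simp
    calc _ = ‖(gaussPrincipal a (b + 1) (c + n) z - 1) -
          a / (c + n) * z * gaussPrincipal (a + 1) (b + 1) (c + 1 + n) z‖ := by ring_nf
      _ ≤ M₁ / n + 2 * ‖a‖ * max R 0 / n * (|M₂| + 1) := by
        refine (norm_sub_le _ _).trans (add_le_add (h1 z hz) ?_)
        rw [norm_mul]
        gcongr
      _ = _ := by ring

/-- `₂F₁(a, b; c + n; z) = 1 + O(1/n)`, uniformly on compact subsets of the cut plane. -/
theorem exists_bound_gaussPrincipal_sub_one (a b : ℂ) (hc : ∀ m : ℕ, c ≠ -(m : ℂ))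
    (hK : IsCompact K) (hKc : K ⊆ cutPlane) :
    ∃ M : ℝ, ∀ᶠ n : ℕ in atTop, ∀ z ∈ K, ‖gaussPrincipal a b (c + n) z - 1‖ ≤ M / n := by
  obtain ⟨m, hm⟩ := exists_nat_gt (-b.re)
  exact exists_bound_gaussPrincipal_sub_one_of_neg hK hKc m a b c (by linarith) hc

theorem tendsto_gaussPrincipal (a b : ℂ) (hc : ∀ m : ℕ, c ≠ -(m : ℂ)) {z : ℂ}
    (hz : z ∈ cutPlane) :
    Tendsto (fun n : ℕ => gaussPrincipal a b (c + n) z) atTop (𝓝 1) := by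
  obtain ⟨M, hM⟩ := exists_bound_gaussPrincipal_sub_one a b hc isCompact_singleton
    (Set.singleton_subset_iff.2 hz)
  rw [tendsto_iff_norm_sub_tendsto_zero]
  exact squeeze_zero' (Eventually.of_forall fun _ => norm_nonneg _)
    (hM.mono fun n hn => hn z rfl) (tendsto_const_div_atTop_nhds_zero_nat M)

end Asymptotics

/-! ### Boundary values on the cut -/

section Boundary

open Complex

variable {a b c z : ℂ} {σ : CutSide}

/-- The pair `Y` solves a linear system whose coefficients are bounded where `|z|` and `|1-z|` are
at least `δ`. Gronwall's inequality along the segment from a fixed `p ∈ S` to `z` bounds `Y`, and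
then the system bounds the derivative. Nothing depends on the distance from `S` to the cut. -/
theorem exists_bound_of_convex (a b : ℂ) (hc : ∀ m : ℕ, c ≠ -(m : ℂ)) {S : Set ℂ}
    (hS : Convex ℝ S) (hSc : S ⊆ cutPlane) (hSb : Bornology.IsBounded S) {δ : ℝ} (hδ : 0 < δ)
    (h0 : ∀ z ∈ S, δ ≤ ‖z‖) (h1 : ∀ z ∈ S, δ ≤ ‖1 - z‖) :
    ∃ M : ℝ, ∀ z ∈ S, ‖gaussPrincipal a b c z‖ ≤ M ∧ ‖deriv (gaussPrincipal a b c) z‖ ≤ M := by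
  rcases S.eq_empty_or_nonempty with rfl | ⟨p, hp⟩
  · exact ⟨0, by simp⟩
  have hc' := not_neg_nat_add_one hc
  have hc0 := norm_pos_iff.2 (ne_zero_of_not_neg_nat hc)
  set Y : ℂ → ℂ × ℂ := fun z => (gaussPrincipal a b c z, gaussPrincipal a b (c + 1) z) with hY
  set L₁ := (‖(c - a) * (c - b)‖ + ‖c * (a + b - c)‖) / (‖c‖ * δ) with hL₁
  set L₂ := 2 * ‖c‖ / δ with hL₂
  have hL₁0 : 0 ≤ L₁ := by positivity
  have hL₂0 : 0 ≤ L₂ := by positivity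
  have hd₁ : ∀ z ∈ S, ‖deriv (gaussPrincipal a b c) z‖ ≤ L₁ * ‖Y z‖ := by
    intro z hz
    have e := congrArg norm (gaussPrincipal_deriv_right (a := a) (b := b) hc (hSc hz))
    rw [norm_mul, norm_mul] at e
    have e1 : ‖gaussPrincipal a b c z‖ ≤ ‖Y z‖ := norm_fst_le (Y z)
    have e2 : ‖gaussPrincipal a b (c + 1) z‖ ≤ ‖Y z‖ := norm_snd_le (Y z)
    have e3 : ‖c‖ * δ * ‖deriv (gaussPrincipal a b c) z‖ ≤
        (‖(c - a) * (c - b)‖ + ‖c * (a + b - c)‖) * ‖Y z‖ := by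
      calc _ ≤ ‖c‖ * ‖1 - z‖ * ‖deriv (gaussPrincipal a b c) z‖ := by gcongr; exact h1 z hz
        _ ≤ ‖(c - a) * (c - b)‖ * ‖Y z‖ + ‖c * (a + b - c)‖ * ‖Y z‖ := by
          rw [e]
          refine (norm_add_le _ _).trans ?_
          rw [norm_mul ((c - a) * (c - b)), norm_mul (c * (a + b - c))]
          gcongr
        _ = _ := by ring
    rw [hL₁, div_mul_eq_mul_div, le_div_iff₀ (by positivity)]
    linarith
  have hd₂ : ∀ z ∈ S, ‖deriv (gaussPrincipal a b (c + 1)) z‖ ≤ L₂ * ‖Y z‖ := by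
    intro z hz
    have e := congrArg norm (gaussPrincipal_theta_right (a := a) (b := b) hc (hSc hz))
    rw [norm_mul, norm_mul] at e
    have e1 : ‖gaussPrincipal a b c z‖ ≤ ‖Y z‖ := norm_fst_le (Y z)
    have e2 : ‖gaussPrincipal a b (c + 1) z‖ ≤ ‖Y z‖ := norm_snd_le (Y z)
    have e3 : δ * ‖deriv (gaussPrincipal a b (c + 1)) z‖ ≤ 2 * ‖c‖ * ‖Y z‖ := by
      calc _ ≤ ‖z‖ * ‖deriv (gaussPrincipal a b (c + 1)) z‖ := by gcongr; exact h0 z hz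
        _ ≤ ‖c‖ * (‖Y z‖ + ‖Y z‖) := by
          rw [e]
          gcongr
          exact (norm_sub_le _ _).trans (add_le_add e1 e2)
        _ = _ := by ring
    rw [hL₂, div_mul_eq_mul_div, le_div_iff₀ hδ]
    linarith
  obtain ⟨R, hR⟩ := hSb.exists_norm_le
  have hR0 : 0 ≤ R := (norm_nonneg p).trans (hR p hp)
  have hYb : ∀ z ∈ S, ‖Y z‖ ≤ ‖Y p‖ * Real.exp (max L₁ L₂ * (2 * R) * (1 - 0)) := by
    intro z hz
    have hmem : ∀ t ∈ Set.Icc (0 : ℝ) 1, p + (t : ℂ) * (z - p) ∈ S := fun t ht => by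
      simpa using hS.add_smul_sub_mem hp hz ht
    have hder : ∀ t ∈ Set.Icc (0 : ℝ) 1, HasDerivAt (fun t : ℝ => Y (p + (t : ℂ) * (z - p)))
        (deriv (gaussPrincipal a b c) (p + (t : ℂ) * (z - p)) * (z - p),
          deriv (gaussPrincipal a b (c + 1)) (p + (t : ℂ) * (z - p)) * (z - p)) t := by
      intro t ht
      have g1 : HasDerivAt (fun s : ℂ => p + s * (z - p)) (z - p) (t : ℂ) := by
        simpa using ((hasDerivAt_id (t : ℂ)).mul_const (z - p)).const_add p
      have g2 := ((differentiableAt_gaussPrincipal a b hc (hSc (hmem t ht))).hasDerivAt.comp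
        (t : ℂ) g1).comp_ofReal
      have g3 := ((differentiableAt_gaussPrincipal a b hc' (hSc (hmem t ht))).hasDerivAt.comp
        (t : ℂ) g1).comp_ofReal
      exact g2.prodMk g3
    -- The segment has length at most `2 * R`, which enters as a factor of the Lipschitz constant.
    have key := norm_le_gronwallBound_of_norm_deriv_right_le
      (f := fun t : ℝ => Y (p + (t : ℂ) * (z - p))) (K := max L₁ L₂ * (2 * R)) (ε := 0)
      (δ := ‖Y p‖) (a := 0) (b := 1)
      (fun t ht => (hder t ht).continuousAt.continuousWithinAt)
      (fun t ht => (hder t ⟨ht.1, ht.2.le⟩).hasDerivWithinAt) (by simp) (fun t ht => ?_) 1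
      (by simp)
    · rw [gronwallBound_ε0] at key
      simpa using key
    · have hm := hmem t ⟨ht.1, ht.2.le⟩
      have hzp : ‖z - p‖ ≤ 2 * R := (norm_sub_le _ _).trans (by linarith [hR z hz, hR p hp])
      rw [add_zero]
      refine norm_prod_le_iff.2 ⟨?_, ?_⟩ <;> simp only [norm_mul]
      · calc _ ≤ (L₁ * ‖Y (p + t * (z - p))‖) * (2 * R) := by gcongr; exact hd₁ _ hm
          _ ≤ (max L₁ L₂ * ‖Y (p + t * (z - p))‖) * (2 * R) := by gcongr; exact le_max_left _ _
          _ = _ := by ring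
      · calc _ ≤ (L₂ * ‖Y (p + t * (z - p))‖) * (2 * R) := by gcongr; exact hd₂ _ hm
          _ ≤ (max L₁ L₂ * ‖Y (p + t * (z - p))‖) * (2 * R) := by gcongr; exact le_max_right _ _
          _ = _ := by ring
  set B := ‖Y p‖ * Real.exp (max L₁ L₂ * (2 * R) * (1 - 0)) with hB
  have hB0 : 0 ≤ B := by positivity
  refine ⟨max B (L₁ * B), fun z hz => ⟨?_, ?_⟩⟩
  · exact ((norm_fst_le (Y z)).trans (hYb z hz)).trans (le_max_left _ _)
  · refine ((hd₁ z hz).trans ?_).trans (le_max_right _ _)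
    gcongr
    exact hYb z hz

theorem not_mem_cutPlane_iff : z ∉ cutPlane ↔ 1 ≤ z.re ∧ z.im = 0 := by
  simp [cutPlane, mem_slitPlane_iff, not_or]

theorem halfPlane_subset_cutPlane : σ.halfPlane ⊆ cutPlane := by
  intro z hz
  by_contra h
  have h2 := (not_mem_cutPlane_iff.1 h).2
  cases σ <;> simp [CutSide.halfPlane, h2] at hz

theorem convex_halfPlane : Convex ℝ σ.halfPlane := by
  cases σ
  · exact convex_halfSpace_im_gt 0
  · exact convex_halfSpace_im_lt 0

theorem mem_closure_halfPlane (hz : z.im = 0) : z ∈ closure σ.halfPlane := by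
  cases σ
  · simp only [CutSide.halfPlane, closure_setOfPred_lt_im]
    exact hz.ge
  · simp only [CutSide.halfPlane, closure_setOfPred_im_lt]
    exact hz.le

theorem exists_bound_near_cut (a b : ℂ) (hc : ∀ m : ℕ, c ≠ -(m : ℂ)) (hz : z ∉ cutPlane)
    (hz1 : z ≠ 1) (σ : CutSide) : ∃ S : Set ℂ, S ∈ 𝓝 z ∧ Convex ℝ (S ∩ σ.halfPlane) ∧
    ∃ M : ℝ, ∀ w ∈ S ∩ σ.halfPlane,
      ‖gaussPrincipal a b c w‖ ≤ M ∧ ‖deriv (gaussPrincipal a b c) w‖ ≤ M := by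
  obtain ⟨h1, h2⟩ := not_mem_cutPlane_iff.1 hz
  have h3 : 1 < z.re := lt_of_le_of_ne h1 fun h => hz1 (Complex.ext h.symm h2)
  -- This radius keeps `Re w ≥ 1 + ε` on the ball, hence `|w| ≥ ε` and `|1-w| ≥ ε`.
  set ε := min ((z.re - 1) / 2) 1 with hε
  have hε0 : 0 < ε := lt_min (by linarith) one_pos
  have hε1 : ε ≤ 1 := min_le_right _ _
  have hε2 : ε ≤ (z.re - 1) / 2 := min_le_left _ _
  have hre : ∀ w ∈ Metric.ball z ε ∩ σ.halfPlane, 1 + ε ≤ w.re := by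
    intro w hw
    have := (abs_re_le_norm (w - z)).trans_lt (mem_ball_iff_norm.1 hw.1)
    rw [sub_re, abs_lt] at this
    linarith
  have hconv : Convex ℝ (Metric.ball z ε ∩ σ.halfPlane) := (convex_ball z ε).inter convex_halfPlane
  refine ⟨Metric.ball z ε, Metric.ball_mem_nhds z hε0, hconv, ?_⟩
  refine exists_bound_of_convex a b hc hconv (Set.inter_subset_right.trans halfPlane_subset_cutPlane)
    (Metric.isBounded_ball.subset Set.inter_subset_left) hε0 (fun w hw => ?_) (fun w hw => ?_)
  · linarith [hre w hw, re_le_norm w]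
  · have := abs_re_le_norm (1 - w)
    rw [sub_re, one_re, abs_sub_comm] at this
    linarith [hre w hw, le_abs_self (w.re - 1)]

/-- A bounded derivative on a convex one-sided neighbourhood makes the function Lipschitz there, so
it maps the one-sided filter to a Cauchy filter. -/
theorem exists_tendsto_gaussPrincipal (a b : ℂ) (hc : ∀ m : ℕ, c ≠ -(m : ℂ)) (hz : z ∉ cutPlane)
    (hz1 : z ≠ 1) (σ : CutSide) :
    ∃ l, Tendsto (gaussPrincipal a b c) (𝓝[σ.halfPlane] z) (𝓝 l) := by
  obtain ⟨S, hS, hconv, M, hM⟩ := exists_bound_near_cut a b hc hz hz1 σ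
  have : (𝓝[σ.halfPlane] z).NeBot :=
    mem_closure_iff_nhdsWithin_neBot.1 (mem_closure_halfPlane (not_mem_cutPlane_iff.1 hz).2)
  have hlip : LipschitzOnWith M.toNNReal (gaussPrincipal a b c) (S ∩ σ.halfPlane) := by
    refine hconv.lipschitzOnWith_of_nnnorm_deriv_le (𝕜 := ℂ) (fun w hw =>
      differentiableAt_gaussPrincipal a b hc (halfPlane_subset_cutPlane hw.2)) fun w hw => ?_
    rw [← NNReal.coe_le_coe, coe_nnnorm]
    exact (hM w hw).2.trans (Real.le_coe_toNNReal M)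
  have hcauchy : Cauchy (𝓝[σ.halfPlane] z) := cauchy_nhds.mono nhdsWithin_le_nhds
  have hle : 𝓝[σ.halfPlane] z ≤ 𝓟 (S ∩ σ.halfPlane) :=
    le_principal_iff.2 (inter_mem (mem_nhdsWithin_of_mem_nhds hS) self_mem_nhdsWithin)
  exact CompleteSpace.complete (hcauchy.map_of_le hlip.uniformContinuousOn hle)

/-- The filter along which the values of the hypergeometric function at `z` are limits of values of
the principal branch. -/
noncomputable def sideFilter (σ : CutSide) (z : ℂ) : Filter ℂ := 𝓝 z ⊓ 𝓟 (cutPlane ∩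
  {w | z ∈ cutPlane ∨ w ∈ σ.halfPlane})

theorem sideFilter_le_nhds : sideFilter σ z ≤ 𝓝 z := inf_le_left

theorem sideFilter_of_mem (hz : z ∈ cutPlane) : sideFilter σ z = 𝓝 z := by
  refine inf_eq_left.2 (le_principal_iff.2 ?_)
  filter_upwards [isOpen_cutPlane.mem_nhds hz] with w hw
  exact ⟨hw, Or.inl hz⟩

theorem sideFilter_of_not_mem (hz : z ∉ cutPlane) : sideFilter σ z = 𝓝[σ.halfPlane] z := by
  have : cutPlane ∩ {w | z ∈ cutPlane ∨ w ∈ σ.halfPlane} = σ.halfPlane := by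
    ext w
    simp only [hz, false_or, Set.mem_inter_iff]
    exact ⟨fun h => h.2, fun h => ⟨halfPlane_subset_cutPlane h, h⟩⟩
  rw [sideFilter, this]
  rfl

theorem eventually_sideFilter_mem_cutPlane : ∀ᶠ w in sideFilter σ z, w ∈ cutPlane := by
  refine Filter.Eventually.filter_mono inf_le_right ?_
  exact eventually_principal.2 fun w hw => hw.1

instance sideFilter_neBot : (sideFilter σ z).NeBot := by
  by_cases hz : z ∈ cutPlane
  · rw [sideFilter_of_mem hz]
    infer_instance
  · rw [sideFilter_of_not_mem hz]
    exact mem_closure_iff_nhdsWithin_neBot.1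
      (mem_closure_halfPlane (not_mem_cutPlane_iff.1 hz).2)

theorem tendsto_gauss2F1 (a b : ℂ) (hc : ∀ m : ℕ, c ≠ -(m : ℂ)) (hz : z ≠ 1) :
    Tendsto (gaussPrincipal a b c) (sideFilter σ z) (𝓝 (gauss2F1 σ a b c z)) := by
  by_cases hzc : z ∈ cutPlane
  · rw [sideFilter_of_mem hzc, gauss2F1, if_pos hzc]
    exact (differentiableAt_gaussPrincipal a b hc hzc).continuousAt
  · rw [sideFilter_of_not_mem hzc, gauss2F1, if_neg hzc]
    exact tendsto_nhds_limUnder (exists_tendsto_gaussPrincipal a b hc hzc hz σ)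

theorem gauss2F1_of_mem (hz : z ∈ cutPlane) : gauss2F1 σ a b c z = gaussPrincipal a b c z :=
  if_pos hz

/-- At a cut point the function may jump, but it is bounded on each side separately. -/
theorem exists_bound_nhds (a b : ℂ) (hc : ∀ m : ℕ, c ≠ -(m : ℂ)) (hz : z ≠ 1) :
    ∃ M : ℝ, ∀ᶠ w in 𝓝 z, w ∈ cutPlane → ‖gaussPrincipal a b c w‖ ≤ M := by
  by_cases hzc : z ∈ cutPlane
  · refine ⟨‖gaussPrincipal a b c z‖ + 1, ?_⟩
    filter_upwards [(differentiableAt_gaussPrincipal a b hc hzc).continuousAt.norm.eventually_lt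
      continuousAt_const (lt_add_one _)] with w hw _
    exact hw.le
  · obtain ⟨S₁, hS₁, -, M₁, hM₁⟩ := exists_bound_near_cut a b hc hzc hz .above
    obtain ⟨S₂, hS₂, -, M₂, hM₂⟩ := exists_bound_near_cut a b hc hzc hz .below
    have h3 : 1 < z.re := lt_of_le_of_ne (not_mem_cutPlane_iff.1 hzc).1 fun h =>
      hz (Complex.ext h.symm (not_mem_cutPlane_iff.1 hzc).2)
    refine ⟨max M₁ M₂, ?_⟩
    filter_upwards [hS₁, hS₂, continuous_re.continuousAt.eventually_const_lt h3] with w h1 h2 h3 hw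
    rcases lt_trichotomy w.im 0 with h | h | h
    · exact (hM₂ w ⟨h2, h⟩).1.trans (le_max_right _ _)
    · exact absurd hw (not_mem_cutPlane_iff.2 ⟨h3.le, h⟩)
    · exact (hM₁ w ⟨h1, h⟩).1.trans (le_max_left _ _)

theorem exists_bound_of_isCompact (a b : ℂ) (hc : ∀ m : ℕ, c ≠ -(m : ℂ)) {K : Set ℂ}
    (hK : IsCompact K) (h1 : (1 : ℂ) ∉ K) :
    ∃ M : ℝ, ∀ w ∈ K ∩ cutPlane, ‖gaussPrincipal a b c w‖ ≤ M := by
  refine hK.induction_on (p := fun s => ∃ M : ℝ, ∀ w ∈ s ∩ cutPlane, ‖gaussPrincipal a b c w‖ ≤ M)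
    ⟨0, by simp⟩ ?_ ?_ ?_
  · rintro s t hst ⟨M, hM⟩
    exact ⟨M, fun w hw => hM w ⟨hst hw.1, hw.2⟩⟩
  · rintro s t ⟨M₁, h₁⟩ ⟨M₂, h₂⟩
    refine ⟨max M₁ M₂, ?_⟩
    rintro w ⟨hw | hw, hwc⟩
    · exact (h₁ w ⟨hw, hwc⟩).trans (le_max_left _ _)
    · exact (h₂ w ⟨hw, hwc⟩).trans (le_max_right _ _)
  · intro z hz
    obtain ⟨M, hM⟩ := exists_bound_nhds a b hc (z := z) fun h => h1 (h ▸ hz)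
    exact ⟨_, mem_nhdsWithin_of_mem_nhds hM, M, fun w hw => hw.1 hw.2⟩

end Boundary

/-! ### Increments of a perturbed contraction -/

section PerturbedContraction

/-- Sequences whose increments contract up to a summable multiple of the sequence converge at the
rate `1/n`, with constants that depend only on the initial values. -/
theorem exists_bound_of_increment_le {ρ M : ℝ} (hρ0 : 0 ≤ ρ) (hρ : ρ < 1) (hM : 0 ≤ M) :
    ∃ D : ℝ, ∃ N₀ : ℕ, ∀ N ≥ N₀, ∀ (X : ℝ) (y : ℕ → ℂ), ‖y N‖ ≤ X →
      ‖y (N + 1) - y N‖ * (N + 1) ^ 2 ≤ X →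
      (∀ n ≥ N, ‖y (n + 2) - y (n + 1)‖ ≤
        ρ * ‖y (n + 1) - y n‖ + M / ((n : ℝ) + 1) ^ 2 * ‖y (n + 1)‖) →
      ∀ n ≥ N, ∀ m ≥ n, ‖y m - y n‖ ≤ D * X / n := by
  have h1ρ : 0 < 1 - ρ := by linarith
  -- `D` is chosen so that the contraction and the perturbation (with `‖y‖ ≤ 2X`) together contract
  -- by `(1+ρ)/2`.
  set D := 4 * M / (1 - ρ) + 1 with hD
  have hD1 : 1 ≤ D := by
    have : 0 ≤ 4 * M / (1 - ρ) := by positivity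
    linarith
  have hDM : ρ * D + 2 * M ≤ (1 + ρ) / 2 * D := by
    have : 4 * M ≤ (1 - ρ) * D := by
      rw [hD, mul_add, mul_div_cancel₀ _ h1ρ.ne']
      linarith
    linarith
  -- `N₁` lets the factor `(1+ρ)/2` absorb `(n+2)²/(n+1)²`; `N₂` gives `D X/N ≤ X` for the start of
  -- the induction.
  obtain ⟨N₁, hN₁⟩ := exists_nat_gt (6 / (1 - ρ))
  obtain ⟨N₂, hN₂⟩ := exists_nat_gt D
  refine ⟨D, max (max N₁ N₂) 1, fun N hN X y hX hX' hrec => ?_⟩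
  have hX0 : 0 ≤ X := (norm_nonneg _).trans hX
  have hN1 : N₁ ≤ N := (le_max_left _ _).trans ((le_max_left _ _).trans hN)
  have hN2 : N₂ ≤ N := (le_max_right _ _).trans ((le_max_left _ _).trans hN)
  have hN3 : 1 ≤ N := (le_max_right _ _).trans hN
  have hstep : ∀ n ≥ N, (0 : ℝ) < n ∧ (1 + ρ) / 2 * ((n : ℝ) + 2) ^ 2 ≤ ((n : ℝ) + 1) ^ 2 := by
    intro n hn
    have h1 : (N₁ : ℝ) ≤ n := by exact_mod_cast hN1.trans hn
    have h2 : (1 : ℝ) ≤ n := by exact_mod_cast hN3.trans hn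
    have h3 : 6 ≤ (1 - ρ) * n := by
      have := (div_lt_iff₀ h1ρ).1 (hN₁.trans_le h1)
      linarith
    refine ⟨by linarith, ?_⟩
    have h4 : 6 * (n + 1 : ℝ) ≤ (1 - ρ) * n * (n + 1) := by gcongr
    nlinarith
  have hinv : ∀ n : ℕ, 0 < (n : ℝ) → D * X / ((n : ℝ) + 1) ^ 2 ≤ D * X / n - D * X / (n + 1) := by
    intro n hn
    have : D * X / n - D * X / (n + 1) = D * X / (n * (n + 1)) := by
      field_simp
      ring
    rw [this]
    gcongr
    nlinarith
  -- Joint induction: the increment bound needs `‖y‖ ≤ 2X`, and the term `-D X/n` pays for the next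
  -- increment since `1/(n+1)² ≤ 1/n - 1/(n+1)`.
  have key : ∀ n ≥ N, ‖y n‖ ≤ 2 * X - D * X / n ∧ ‖y (n + 1) - y n‖ ≤ D * X / ((n : ℝ) + 1) ^ 2 := by
    intro n hn
    induction n, hn using Nat.le_induction with
    | base =>
      have h2 := (hstep N le_rfl).1
      refine ⟨?_, ?_⟩
      · have h3 : D ≤ N := hN₂.le.trans (by exact_mod_cast hN2)
        have : D * X / N ≤ X := by
          rw [div_le_iff₀ h2, mul_comm]
          gcongr
        linarith
      · rw [le_div_iff₀ (by positivity)]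
        nlinarith
    | succ n hn ih =>
      obtain ⟨ih1, ih2⟩ := ih
      obtain ⟨hn0, hn1⟩ := hstep n hn
      have h1 : ‖y (n + 1)‖ ≤ 2 * X - D * X / ((n + 1 : ℕ) : ℝ) := by
        have := norm_le_norm_sub_add (y (n + 1)) (y n)
        have := hinv n hn0
        push_cast
        linarith
      refine ⟨h1, ?_⟩
      have h2 : ‖y (n + 1)‖ ≤ 2 * X := h1.trans (sub_le_self _ (by positivity))
      calc ‖y (n + 1 + 1) - y (n + 1)‖ ≤
          ρ * (D * X / ((n : ℝ) + 1) ^ 2) + M / ((n : ℝ) + 1) ^ 2 * (2 * X) := by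
            refine (hrec n hn).trans ?_
            gcongr
        _ = (ρ * D + 2 * M) * X / ((n : ℝ) + 1) ^ 2 := by ring
        _ ≤ ((1 + ρ) / 2 * D) * X / ((n : ℝ) + 1) ^ 2 := by gcongr
        _ ≤ D * X / (((n + 1 : ℕ) : ℝ) + 1) ^ 2 := by
          rw [div_le_div_iff₀ (by positivity) (by positivity)]
          push_cast
          have : 0 ≤ D * X := by positivity
          nlinarith
  intro n hn m hm
  have hn0 := (hstep n hn).1
  have : ‖y m - y n‖ ≤ D * X / n - D * X / m := by
    induction m, hm using Nat.le_induction with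
    | base => simp
    | succ m hm ih =>
      have h1 := norm_sub_le_norm_sub_add_norm_sub (y (m + 1)) (y m) (y n)
      have h2 := (key m (hn.trans hm)).2
      have h3 := hinv m (hstep m (hn.trans hm)).1
      push_cast
      linarith
  exact this.trans (sub_le_self _ (by positivity))

end PerturbedContraction

/-! ### Large `c` for `Re z > 1/2`, uniformly up to the cut -/

section RightHalfPlane

open Complex

variable {a b c : ℂ} {K : Set ℂ}

theorem tendsto_add_nat_div_add_nat (u v : ℂ) :
    Tendsto (fun n : ℕ => (u + n) / (v + n)) atTop (𝓝 1) := by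
  simpa using tendsto_add_mul_div_add_mul_atTop_nhds u v (1 : ℂ) one_ne_zero

theorem eventually_add_nat_ne_zero (u : ℂ) : ∀ᶠ n : ℕ in atTop, u + n ≠ 0 := by
  obtain ⟨N, hN⟩ := exists_nat_gt ‖u‖
  filter_upwards [eventually_ge_atTop N] with n hn h
  have h1 : (N : ℝ) ≤ n := by exact_mod_cast hn
  have h2 : ‖u‖ = n := by rw [eq_neg_of_add_eq_zero_left h]; simp
  linarith

theorem norm_sub_one_lt_norm_iff {z : ℂ} : ‖z - 1‖ < ‖z‖ ↔ 1 / 2 < z.re := by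
  rw [← sq_lt_sq₀ (norm_nonneg _) (norm_nonneg _), Complex.sq_norm, Complex.sq_norm, normSq_apply,
    normSq_apply]
  simp only [sub_re, one_re, sub_im, one_im, sub_zero]
  constructor <;> intro h <;> nlinarith

theorem exists_ratio_bound (hK : IsCompact K) (hKr : ∀ z ∈ K, 1 / 2 < z.re) :
    ∃ ρ : ℝ, 0 ≤ ρ ∧ ρ < 1 ∧ ∀ z ∈ K, ‖(z - 1) / z‖ ≤ ρ := by
  rcases K.eq_empty_or_nonempty with rfl | hne
  · exact ⟨0, le_rfl, one_pos, by simp⟩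
  have h0 : ∀ z ∈ K, z ≠ 0 := by
    rintro z hz rfl
    have := hKr 0 hz
    norm_num at this
  obtain ⟨x, hx, hmax⟩ := hK.exists_isMaxOn hne (f := fun z : ℂ => ‖(z - 1) / z‖)
    (ContinuousOn.norm (ContinuousOn.div (by fun_prop) (by fun_prop) h0))
  refine ⟨‖(x - 1) / x‖, norm_nonneg _, ?_, fun z hz => hmax hz⟩
  rw [norm_div, div_lt_one (norm_pos_iff.2 (h0 x hx))]
  exact norm_sub_one_lt_norm_iff.2 (hKr x hx)

/-- `K` may meet the cut, so `K ∩ cutPlane` need not be compact. Uniformity comes from bounding two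
initial values by `exists_bound_of_isCompact` and propagating them by the recurrence; the limit `1`
is needed only pointwise. -/
theorem exists_bound_gaussPrincipal_sub_one_right (a b : ℂ) (hc : ∀ m : ℕ, c ≠ -(m : ℂ))
    (hK : IsCompact K) (hKr : ∀ z ∈ K, 1 / 2 < z.re) (h1 : (1 : ℂ) ∉ K) :
    ∃ M : ℝ, ∀ᶠ n : ℕ in atTop, ∀ z ∈ K ∩ cutPlane, ‖gaussPrincipal a b (c + n) z - 1‖ ≤ M / n := by
  obtain ⟨ρ₀, hρ₀0, hρ₀1, hρ₀⟩ := exists_ratio_bound hK hKr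
  -- The slack over `ρ₀` and over `‖a * b‖` absorbs coefficient quotients that tend to `1`.
  set ρ := (1 + ρ₀) / 2 with hρ
  set M := ‖a * b‖ + 1 with hM
  obtain ⟨D, N₀, hD⟩ := exists_bound_of_increment_le (ρ := ρ) (M := M) (by linarith)
    (by linarith) (by positivity)
  have l1 : Tendsto (fun n : ℕ => ‖(c + 1 + n) / (c + 1 - a + n) * ((c + n) / (c + 1 - b + n))‖ * ρ₀)
      atTop (𝓝 ρ₀) := by
    simpa using (((tendsto_add_nat_div_add_nat (c + 1) (c + 1 - a)).mul
      (tendsto_add_nat_div_add_nat c (c + 1 - b))).norm).mul_const ρ₀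
  have l2 : Tendsto (fun n : ℕ => ‖(1 + n : ℂ) / (c + 1 - a + n) * ((1 + n) / (c + 1 - b + n))‖ *
      ‖a * b‖) atTop (𝓝 ‖a * b‖) := by
    simpa using (((tendsto_add_nat_div_add_nat 1 (c + 1 - a)).mul
      (tendsto_add_nat_div_add_nat 1 (c + 1 - b))).norm).mul_const ‖a * b‖
  obtain ⟨N, hN⟩ := eventually_atTop.1 ((l1.eventually_lt_const (by linarith : ρ₀ < ρ)).and
    ((l2.eventually_lt_const (by linarith : ‖a * b‖ < M)).and
    ((eventually_add_nat_ne_zero (c + 1 - a)).and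
    ((eventually_add_nat_ne_zero (c + 1 - b)).and (eventually_ge_atTop N₀)))))
  obtain ⟨X₁, hX₁⟩ := exists_bound_of_isCompact a b (not_neg_nat_add hc N) hK h1
  obtain ⟨X₂, hX₂⟩ := exists_bound_of_isCompact a b (not_neg_nat_add hc (N + 1)) hK h1
  set X := |X₁| + (|X₁| + |X₂|) * (N + 1) ^ 2 with hX
  refine ⟨D * X, eventually_atTop.2 ⟨N, fun n hn z hz => ?_⟩⟩
  have hz0 : z ≠ 0 := by
    rintro rfl
    have := hKr 0 hz.1
    norm_num at this
  have key := hD N (hN N le_rfl).2.2.2.2 X (fun n => gaussPrincipal a b (c + n) z) ?_ ?_ ?_ n hn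
  · have h2 : Tendsto (fun m : ℕ => ‖gaussPrincipal a b (c + m) z - gaussPrincipal a b (c + n) z‖)
        atTop (𝓝 ‖1 - gaussPrincipal a b (c + n) z‖) :=
      ((tendsto_gaussPrincipal a b hc hz.2).sub_const _).norm
    rw [norm_sub_rev]
    exact le_of_tendsto h2 (eventually_atTop.2 ⟨n, key⟩)
  · refine ((hX₁ z hz).trans (le_abs_self _)).trans ?_
    rw [hX]
    exact le_add_of_nonneg_right (by positivity)
  · have e1 := (hX₁ z hz).trans (le_abs_self _)
    have e2 := (hX₂ z hz).trans (le_abs_self _)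
    calc _ ≤ (|X₂| + |X₁|) * ((N : ℝ) + 1) ^ 2 := by
          gcongr
          exact (norm_sub_le _ _).trans (add_le_add e2 e1)
      _ ≤ X := by
        rw [hX, add_comm |X₂|]
        exact le_add_of_nonneg_left (abs_nonneg _)
  · intro k hk
    obtain ⟨g1, g2, g3, g4, -⟩ := hN k hk
    have g5 := gaussPrincipal_three_term (a := a) (b := b) (not_neg_nat_add hc k) hz.2
    have e1 : c + (k + 1 : ℕ) = c + k + 1 := by push_cast; ring
    have e2 : c + (k + 2 : ℕ) = c + k + 1 + 1 := by push_cast; ring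
    simp only [e1, e2]
    set y₀ := gaussPrincipal a b (c + k) z
    set y₁ := gaussPrincipal a b (c + k + 1) z
    set y₂ := gaussPrincipal a b (c + k + 1 + 1) z
    -- The recurrence in terms of increments; its coefficients sum to a multiple of `a * b` that
    -- stays bounded in `k`, whence the remainder of order `1/k²`.
    have g6 : y₂ - y₁ = (c + 1 + k) / (c + 1 - a + k) * ((c + k) / (c + 1 - b + k)) *
        ((z - 1) / z) * (y₁ - y₀) - a * b / ((c + 1 - a + k) * (c + 1 - b + k)) * y₁ := by
      field_simp
      simp only [A13, B13, C13] at g5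
      linear_combination g5
    have hk0 : (1 + k : ℂ) ≠ 0 := by rw [add_comm]; exact_mod_cast k.succ_ne_zero
    have g7 : ‖a * b / ((c + 1 - a + k) * (c + 1 - b + k))‖ ≤ M / ((k : ℝ) + 1) ^ 2 := by
      have e3 : a * b / ((c + 1 - a + k) * (c + 1 - b + k)) =
          (1 + k : ℂ) / (c + 1 - a + k) * ((1 + k) / (c + 1 - b + k)) * (a * b) / (1 + k) ^ 2 := by
        field_simp
      have e4 : ‖(1 + k : ℂ)‖ = (k : ℝ) + 1 := by
        rw [add_comm, ← Nat.cast_succ, norm_natCast]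
        push_cast
        rfl
      rw [e3, norm_div, norm_mul, norm_pow, e4]
      gcongr
    rw [g6]
    refine (norm_sub_le _ _).trans ?_
    rw [norm_mul, norm_mul, norm_mul (a * b / _)]
    gcongr
    refine le_trans ?_ g1.le
    gcongr
    exact hρ₀ z hz.1

end RightHalfPlane

/-! ### Asymptotics and recurrence including boundary values -/

section UniformAsymptotics

open Complex

variable {a b c : ℂ} {K : Set ℂ} {σ : CutSide}

/-- `₂F₁(a, b; c + n; z) = 1 + O(1/n)`, uniformly on compact sets that do not contain `1`. -/
theorem exists_bound_gauss2F1_sub_one (σ : CutSide) (a b : ℂ) (hc : ∀ m : ℕ, c ≠ -(m : ℂ))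
    (hK : IsCompact K) (h1 : (1 : ℂ) ∉ K) :
    ∃ M : ℝ, ∀ᶠ n : ℕ in atTop, ∀ z ∈ K, ‖gauss2F1 σ a b (c + n) z - 1‖ ≤ M / n := by
  have hK₁ : IsCompact (K ∩ {z | z.re ≤ 3 / 4}) :=
    hK.inter_right (isClosed_le continuous_re continuous_const)
  have hK₂ : IsCompact (K ∩ {z | 3 / 4 ≤ z.re}) :=
    hK.inter_right (isClosed_le continuous_const continuous_re)
  have hK₁c : K ∩ {z | z.re ≤ 3 / 4} ⊆ cutPlane := by
    intro z hz
    by_contra h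
    have h2 : z.re ≤ 3 / 4 := hz.2
    linarith [(not_mem_cutPlane_iff.1 h).1]
  obtain ⟨M₁, hM₁⟩ := exists_bound_gaussPrincipal_sub_one a b hc hK₁ hK₁c
  have hU : IsOpen {z : ℂ | 1 / 2 < z.re ∧ z ≠ 1} :=
    (isOpen_lt continuous_const continuous_re).inter isOpen_ne
  -- `L` is a compact neighbourhood of the right part of `K`: a boundary value at a point of `K` is
  -- a limit of values at points of `L` off the cut.
  obtain ⟨L, hL, hKL, hLU⟩ := exists_compact_between hK₂ hU fun z hz => by
    have h2 : 3 / 4 ≤ z.re := hz.2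
    exact ⟨by linarith, fun h => h1 (h ▸ hz.1)⟩
  obtain ⟨M₂, hM₂⟩ := exists_bound_gaussPrincipal_sub_one_right a b hc hL
    (fun z hz => (hLU hz).1) fun h => (hLU h).2 rfl
  refine ⟨max M₁ M₂, ?_⟩
  filter_upwards [hM₁, hM₂] with n h2 h3 z hz
  rcases le_total z.re (3 / 4) with h | h
  · rw [gauss2F1_of_mem (hK₁c ⟨hz, h⟩)]
    refine (h2 z ⟨hz, h⟩).trans ?_
    gcongr
    exact le_max_left _ _
  · have h4 := ((tendsto_gauss2F1 (σ := σ) a b (not_neg_nat_add hc n)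
      (fun h => h1 (h ▸ hz))).sub_const 1).norm
    refine le_of_tendsto h4 ?_
    filter_upwards [eventually_sideFilter_mem_cutPlane,
      sideFilter_le_nhds (mem_interior_iff_mem_nhds.1 (hKL ⟨hz, h⟩))] with w hw hwL
    refine (h3 w ⟨hwL, hw⟩).trans ?_
    gcongr
    exact le_max_right _ _

theorem tendsto_gauss2F1_add_nat (σ : CutSide) (a b : ℂ) (hc : ∀ m : ℕ, c ≠ -(m : ℂ)) {z : ℂ}
    (hz : z ≠ 1) : Tendsto (fun n : ℕ => gauss2F1 σ a b (c + n) z) atTop (𝓝 1) := by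
  obtain ⟨M, hM⟩ := exists_bound_gauss2F1_sub_one σ a b hc (isCompact_singleton (x := z))
    fun h => hz (Set.mem_singleton_iff.1 h).symm
  rw [tendsto_iff_norm_sub_tendsto_zero]
  exact squeeze_zero' (Eventually.of_forall fun _ => norm_nonneg _)
    (hM.mono fun n hn => hn z rfl) (tendsto_const_div_atTop_nhds_zero_nat M)

theorem gauss2F1_three_term (σ : CutSide) (a b : ℂ) (hc : ∀ m : ℕ, c ≠ -(m : ℂ)) {z : ℂ}
    (hz : z ≠ 1) :
    A13 (c + 1) z * gauss2F1 σ a b c z + B13 a b (c + 1) z * gauss2F1 σ a b (c + 1) z +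
      C13 a b (c + 1) z * gauss2F1 σ a b (c + 1 + 1) z = 0 := by
  have hc' := not_neg_nat_add_one hc
  have hle : sideFilter σ z ≤ 𝓝 z := sideFilter_le_nhds
  have hA : Tendsto (A13 (c + 1)) (sideFilter σ z) (𝓝 (A13 (c + 1) z)) :=
    (by unfold A13; fun_prop : Continuous (A13 (c + 1))).continuousAt.mono_left hle
  have hB : Tendsto (B13 a b (c + 1)) (sideFilter σ z) (𝓝 (B13 a b (c + 1) z)) :=
    (by unfold B13; fun_prop : Continuous (B13 a b (c + 1))).continuousAt.mono_left hle
  have hC : Tendsto (C13 a b (c + 1)) (sideFilter σ z) (𝓝 (C13 a b (c + 1) z)) :=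
    (by unfold C13; fun_prop : Continuous (C13 a b (c + 1))).continuousAt.mono_left hle
  refine tendsto_nhds_unique (((hA.mul (tendsto_gauss2F1 a b hc hz)).add
    (hB.mul (tendsto_gauss2F1 a b hc' hz))).add
    (hC.mul (tendsto_gauss2F1 a b (not_neg_nat_add_one hc') hz)))
    (tendsto_const_nhds.congr' ?_)
  filter_upwards [eventually_sideFilter_mem_cutPlane] with w hw
  exact (gaussPrincipal_three_term hc hw).symm

end UniformAsymptotics

/-! ### Euler's transformation -/

section EulerTransformation

open Complex

variable {a b c z : ℂ} {σ : CutSide}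

theorem eventually_mul_deriv_pow_mul {v V : ℂ → ℂ} {m : ℕ} (hV : AnalyticAt ℂ V 0)
    (h : ∀ᶠ z in 𝓝 (0 : ℂ), v z = z ^ m * V z) :
    ∀ᶠ z in 𝓝 (0 : ℂ), z * deriv v z = z ^ m * (m * V z + z * deriv V z) := by
  filter_upwards [h.eventually_nhds, hV.eventually_analyticAt] with z hz hVz
  have h1 : deriv v z = m * z ^ (m - 1) * V z + z ^ m * deriv V z := by
    rw [EventuallyEq.deriv_eq (f := fun z => z ^ m * V z) hz]
    exact ((hasDerivAt_pow m z).mul hVz.differentiableAt.hasDerivAt).deriv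
  rw [h1]
  rcases m with _ | m
  · simp
  · simp
    ring

theorem eq_at_zero_of_pow_mul_eq {G H : ℂ → ℂ} (m : ℕ) (hG : ContinuousAt G 0)
    (hH : ContinuousAt H 0) (h : ∀ᶠ z in 𝓝 (0 : ℂ), z ^ m * G z = z ^ m * H z) : G 0 = H 0 := by
  refine tendsto_nhds_unique (hG.tendsto.mono_left nhdsWithin_le_nhds)
    ((hH.tendsto.mono_left (nhdsWithin_le_nhds (s := {0}ᶜ))).congr' ?_)
  filter_upwards [h.filter_mono nhdsWithin_le_nhds, self_mem_nhdsWithin] with z hz hz0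
  exact (mul_left_cancel₀ (pow_ne_zero m hz0) hz).symm

/-- A solution of the first-order system satisfied by `₂F₁(a, b; c; z)` and `₂F₁(a, b; c + 1; z)`
that is holomorphic at `0` and vanishes there is zero. -/
theorem eventually_eq_zero_of_system (hc : ∀ m : ℕ, c ≠ -(m : ℂ)) {p q : ℂ} {u v : ℂ → ℂ}
    (hu : AnalyticAt ℂ u 0) (hv : AnalyticAt ℂ v 0) (hv0 : v 0 = 0)
    (h₁ : ∀ᶠ z in 𝓝 (0 : ℂ), z * deriv u z = c * (v z - u z))
    (h₂ : ∀ᶠ z in 𝓝 (0 : ℂ), c * (1 - z) * deriv v z = p * u z + q * v z) :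
    ∀ᶠ z in 𝓝 (0 : ℂ), v z = 0 := by
  have hc0 := ne_zero_of_not_neg_nat hc
  -- Both functions vanish to every order at `0`. At order `m` the second equation gives `c m V(0) =
  -- 0` (for `m = 0` the initial value is used), and then the first gives `(c + m) U(0) = 0`.
  have key : ∀ m : ℕ, (m : ℕ∞) ≤ analyticOrderAt u 0 ∧ (m : ℕ∞) ≤ analyticOrderAt v 0 := by
    intro m
    induction m with
    | zero => simp
    | succ m ih =>
      obtain ⟨U, hU, hU'⟩ := (natCast_le_analyticOrderAt hu).1 ih.1
      obtain ⟨V, hV, hV'⟩ := (natCast_le_analyticOrderAt hv).1 ih.2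
      simp only [sub_zero, smul_eq_mul] at hU' hV'
      have hV0 : V 0 = 0 := by
        rcases Nat.eq_zero_or_pos m with rfl | hm
        · have := hV'.self_of_nhds
          simpa [hv0] using this.symm
        · have h3 := eq_at_zero_of_pow_mul_eq (G := fun z => c * (1 - z) * (m * V z + z * deriv V z))
            (H := fun z => z * (p * U z + q * V z)) m ?_ ?_ ?_
          · simpa [hc0, hm.ne'] using h3
          · have := hV.continuousAt
            have := hV.deriv.continuousAt
            fun_prop
          · have := hV.continuousAt
            have := hU.continuousAt
            fun_prop
          · filter_upwards [h₂, eventually_mul_deriv_pow_mul hV hV', hU', hV'] with z e1 e2 e3 e4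
            rw [e3, e4] at e1
            linear_combination z * e1 - c * (1 - z) * e2
      have hU0 : U 0 = 0 := by
        have h3 := eq_at_zero_of_pow_mul_eq (G := fun z => m * U z + z * deriv U z)
          (H := fun z => c * (V z - U z)) m ?_ ?_ ?_
        · simp only [zero_mul, add_zero, hV0] at h3
          have h4 : (c + m) * U 0 = 0 := by linear_combination h3
          exact (mul_eq_zero.1 h4).resolve_left (add_nat_ne_zero hc m)
        · have := hU.continuousAt
          have := hU.deriv.continuousAt
          fun_prop
        · have := hV.continuousAt
          have := hU.continuousAt
          fun_prop
        · filter_upwards [h₁, eventually_mul_deriv_pow_mul hU hU', hU', hV'] with z e1 e2 e3 e4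
          rw [e3, e4] at e1
          linear_combination e1 - e2
      have aux : ∀ {w W : ℂ → ℂ}, AnalyticAt ℂ w 0 → AnalyticAt ℂ W 0 → W 0 = 0 →
          (∀ᶠ z in 𝓝 (0 : ℂ), w z = z ^ m * W z) → ((m + 1 : ℕ) : ℕ∞) ≤ analyticOrderAt w 0 := by
        intro w W hw hW hW0 h
        have h1 : ((1 : ℕ) : ℕ∞) ≤ analyticOrderAt W 0 := by
          rw [Nat.cast_one, Order.one_le_iff_ne_zero]
          exact hW.analyticOrderAt_ne_zero.2 hW0
        obtain ⟨W₁, hW₁, hW₁'⟩ := (natCast_le_analyticOrderAt hW).1 h1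
        refine (natCast_le_analyticOrderAt hw).2 ⟨W₁, hW₁, ?_⟩
        filter_upwards [h, hW₁'] with z e1 e2
        rw [e1, e2]
        simp only [sub_zero, smul_eq_mul]
        ring
      exact ⟨aux hu hU hU0 hU', aux hv hV hV0 hV'⟩
  rw [← analyticOrderAt_eq_top, ENat.eq_top_iff_forall_ge]
  exact fun m => (key m).2

theorem analyticAt_gauss (hc : ∀ m : ℕ, c ≠ -(m : ℂ)) (a b : ℂ) :
    AnalyticAt ℂ (ordinaryHypergeometric a b c : ℂ → ℂ) 0 := by
  refine DifferentiableOn.analyticAt (s := Metric.ball (0 : ℂ) 1) (fun z hz => ?_)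
    (Metric.ball_mem_nhds (0 : ℂ) one_pos)
  exact (hasDerivAt_gauss hc (mem_ball_zero_iff.1 hz)).differentiableAt.differentiableWithinAt

theorem hasDerivAt_one_sub_cpow (s : ℂ) (hz : z ∈ cutPlane) :
    HasDerivAt (fun z : ℂ => (1 - z) ^ s) (-s * (1 - z) ^ (s - 1)) z := by
  have h : HasDerivAt (fun z : ℂ => 1 - z) (-1) z := (hasDerivAt_id z).const_sub 1
  convert! h.cpow_const (c := s) hz using 1
  ring

theorem differentiableOn_one_sub_cpow (s : ℂ) :
    DifferentiableOn ℂ (fun z : ℂ => (1 - z) ^ s) cutPlane :=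
  fun _ hz => (hasDerivAt_one_sub_cpow s hz).differentiableAt.differentiableWithinAt

/-- `P` and `Q`, the proposed forms of `F(c)` and `F(c+1)`, solve the same system as these. The
differences are holomorphic at `0`, and `F(c) - P` vanishes there. -/
theorem eventually_gauss_euler (a b : ℂ) (hc : ∀ m : ℕ, c ≠ -(m : ℂ)) :
    ∀ᶠ z in 𝓝 (0 : ℂ), ordinaryHypergeometric a b c z =
      (1 - z) ^ (c - a - b) * ordinaryHypergeometric (c - a) (c - b) c z := by
  have hc' := not_neg_nat_add_one hc
  have hc0 := ne_zero_of_not_neg_nat hc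
  set P : ℂ → ℂ := fun z => (1 - z) ^ (c - a - b) * ordinaryHypergeometric (c - a) (c - b) c z
    with hP
  set Q : ℂ → ℂ := fun z => (1 - z) ^ (c - a - b + 1) *
    ordinaryHypergeometric (c - a + 1) (c - b + 1) (c + 1) z with hQ
  have hball : ∀ᶠ z in 𝓝 (0 : ℂ), ‖z‖ < 1 := by
    filter_upwards [Metric.ball_mem_nhds (0 : ℂ) one_pos] with z hz
    exact mem_ball_zero_iff.1 hz
  have hcp : ∀ s : ℂ, AnalyticAt ℂ (fun z : ℂ => (1 - z) ^ s) 0 := fun s =>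
    (differentiableOn_one_sub_cpow s).analyticAt
      (isOpen_cutPlane.mem_nhds (mem_cutPlane_of_norm_lt_one (by simp)))
  have hPa : AnalyticAt ℂ P 0 := (hcp _).mul (analyticAt_gauss hc _ _)
  have hQa : AnalyticAt ℂ Q 0 := (hcp _).mul (analyticAt_gauss hc' _ _)
  have hF := analyticAt_gauss hc a b
  have hG := analyticAt_gauss hc' a b
  have hpow : ∀ z : ℂ, ‖z‖ < 1 →
      (1 - z) ^ (c - a - b) = (1 - z) ^ (c - a - b - 1) * (1 - z) ∧
      (1 - z) ^ (c - a - b + 1) = (1 - z) ^ (c - a - b) * (1 - z) := by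
    intro z hz
    have h1 := one_sub_ne_zero_of_mem_cutPlane (mem_cutPlane_of_norm_lt_one hz)
    refine ⟨?_, ?_⟩
    · nth_rewrite 3 [← cpow_one (1 - z)]
      rw [← cpow_add _ _ h1, sub_add_cancel]
    · rw [cpow_add _ _ h1, cpow_one]
  have hP' : ∀ z : ℂ, ‖z‖ < 1 → c * (1 - z) * deriv P z =
      (c - a) * (c - b) * Q z + c * (a + b - c) * P z := by
    intro z hz
    have h1 := ((hasDerivAt_one_sub_cpow (c - a - b) (mem_cutPlane_of_norm_lt_one hz)).mul
      (hasDerivAt_gauss (a := c - a) (b := c - b) hc hz)).deriv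
    obtain ⟨h2, h3⟩ := hpow z hz
    rw [hP, show (fun z : ℂ => (1 - z) ^ (c - a - b) * ordinaryHypergeometric (c - a) (c - b) c z) =
      (fun z : ℂ => (1 - z) ^ (c - a - b)) * ordinaryHypergeometric (c - a) (c - b) c from rfl, h1,
      hQ]
    simp only [Pi.mul_apply]
    rw [h3, h2]
    field_simp
    ring
  have hQ' : ∀ z : ℂ, ‖z‖ < 1 → z * deriv Q z = c * (P z - Q z) := by
    intro z hz
    have h1 := ((hasDerivAt_one_sub_cpow (c - a - b + 1) (mem_cutPlane_of_norm_lt_one hz)).mul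
      (hasDerivAt_gauss (a := c - a + 1) (b := c - b + 1) hc' hz)).deriv
    have h4 := gauss_deriv_shift (a := c - a) (b := c - b) hc hz
    rw [← (hasDerivAt_gauss (a := c - a + 1) (b := c - b + 1) hc' hz).deriv,
      add_sub_cancel_right] at h1
    obtain ⟨-, h3⟩ := hpow z hz
    rw [hQ, show (fun z : ℂ => (1 - z) ^ (c - a - b + 1) *
      ordinaryHypergeometric (c - a + 1) (c - b + 1) (c + 1) z) =
      (fun z : ℂ => (1 - z) ^ (c - a - b + 1)) *
        ordinaryHypergeometric (c - a + 1) (c - b + 1) (c + 1) from rfl, h1, hP]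
    simp only [Pi.mul_apply]
    rw [h3]
    linear_combination (1 - z) ^ (c - a - b) * h4
  have key := eventually_eq_zero_of_system hc (p := (c - a) * (c - b)) (q := c * (a + b - c))
    (u := ordinaryHypergeometric a b (c + 1) - Q) (v := ordinaryHypergeometric a b c - P)
    (hG.sub hQa) (hF.sub hPa) (by simp [hP]) ?_ ?_
  · filter_upwards [key] with z hz
    exact sub_eq_zero.1 hz
  · filter_upwards [hball, hG.eventually_analyticAt, hQa.eventually_analyticAt] with z hz e1 e2
    rw [deriv_sub e1.differentiableAt e2.differentiableAt, mul_sub, gauss_theta_right hc hz,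
      hQ' z hz]
    simp only [Pi.sub_apply]
    ring
  · filter_upwards [hball, hF.eventually_analyticAt, hPa.eventually_analyticAt] with z hz e1 e2
    rw [deriv_sub e1.differentiableAt e2.differentiableAt, mul_sub, gauss_deriv_right hc hz,
      hP' z hz]
    simp only [Pi.sub_apply]
    ring

/-- Euler's transformation on the cut plane. -/
theorem gaussPrincipal_euler (a b : ℂ) (hc : ∀ m : ℕ, c ≠ -(m : ℂ)) (hz : z ∈ cutPlane) :
    gaussPrincipal a b c z = (1 - z) ^ (c - a - b) * gaussPrincipal (c - a) (c - b) c z := by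
  refine ((differentiableOn_gaussPrincipal a b hc).analyticOnNhd
    isOpen_cutPlane).eqOn_of_preconnected_of_eventuallyEq
    (((differentiableOn_one_sub_cpow (c - a - b)).mul
      (differentiableOn_gaussPrincipal (c - a) (c - b) hc)).analyticOnNhd isOpen_cutPlane)
    isPreconnected_cutPlane (mem_cutPlane_of_norm_lt_one (z := 0) (by simp)) ?_ hz
  filter_upwards [Metric.ball_mem_nhds (0 : ℂ) one_pos, eventually_gauss_euler a b hc] with w hw h
  have hw' := mem_ball_zero_iff.1 hw
  rw [Pi.mul_apply, gaussPrincipal_eq a b hc hw', gaussPrincipal_eq _ _ hc hw', h]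

/-- The branch of `log (1 - z)` on the cut plane, extended to the cut from the side `σ`. -/
noncomputable def sideLog (σ : CutSide) (z : ℂ) : ℂ :=
  limUnder (sideFilter σ z) fun w => log (1 - w)

theorem tendsto_sideLog (hz : z ≠ 1) :
    Tendsto (fun w => log (1 - w)) (sideFilter σ z) (𝓝 (sideLog σ z)) := by
  refine tendsto_nhds_limUnder ?_
  by_cases hzc : z ∈ cutPlane
  · rw [sideFilter_of_mem hzc]
    exact ⟨_, ContinuousAt.clog (by fun_prop) hzc⟩
  · rw [sideFilter_of_not_mem hzc]
    obtain ⟨h1, h2⟩ := not_mem_cutPlane_iff.1 hzc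
    have h3 : 1 < z.re := lt_of_le_of_ne h1 fun h => hz (Complex.ext h.symm h2)
    have hre : (1 - z).re < 0 := by simpa using h3
    have him : (1 - z).im = 0 := by simpa using h2
    have hcont : Tendsto (fun w : ℂ => 1 - w) (𝓝[σ.halfPlane] z) (𝓝 (1 - z)) :=
      ((by fun_prop : Continuous fun w : ℂ => 1 - w).tendsto z).mono_left nhdsWithin_le_nhds
    cases σ with
    -- The map `w ↦ 1 - w` exchanges the two sides of the real axis.
    | above =>
      refine ⟨_, (tendsto_log_nhdsWithin_im_neg_of_re_neg_of_im_zero hre him).comp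
        (tendsto_nhdsWithin_iff.2 ⟨hcont, ?_⟩)⟩
      filter_upwards [self_mem_nhdsWithin] with w hw
      simpa [CutSide.halfPlane] using hw
    | below =>
      refine ⟨_, (tendsto_log_nhdsWithin_im_nonneg_of_re_neg_of_im_zero hre him).comp
        (tendsto_nhdsWithin_iff.2 ⟨hcont, ?_⟩)⟩
      filter_upwards [self_mem_nhdsWithin] with w hw
      have : w.im < 0 := hw
      simpa using this.le

theorem exp_sideLog (hz : z ≠ 1) : exp (sideLog σ z) = 1 - z := by
  refine tendsto_nhds_unique ((continuous_exp.tendsto _).comp (tendsto_sideLog hz))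
    (Tendsto.congr' ?_ (((by fun_prop : Continuous fun w : ℂ => 1 - w).tendsto z).mono_left
      (sideFilter_le_nhds (σ := σ))))
  filter_upwards [eventually_sideFilter_mem_cutPlane] with w hw
  exact (exp_log (one_sub_ne_zero_of_mem_cutPlane hw)).symm

/-- This gives bounds uniform on compact sets, although `sideLog` jumps across the cut. -/
theorem norm_sideLog_le (hz : z ≠ 1) : ‖sideLog σ z‖ ≤ |Real.log ‖1 - z‖| + Real.pi := by
  have h1 : 1 - z ≠ 0 := sub_ne_zero.2 hz.symm
  have h2 : Tendsto (fun w : ℂ => |Real.log ‖1 - w‖| + Real.pi) (sideFilter σ z)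
      (𝓝 (|Real.log ‖1 - z‖| + Real.pi)) := by
    refine ContinuousAt.tendsto ?_ |>.mono_left sideFilter_le_nhds
    have h3 : ContinuousAt (fun w : ℂ => Real.log ‖1 - w‖) z :=
      ContinuousAt.log (by fun_prop) (norm_ne_zero_iff.2 h1)
    exact h3.abs.add continuousAt_const
  refine le_of_tendsto_of_tendsto (tendsto_sideLog (σ := σ) hz).norm h2
    (Eventually.of_forall fun w => ?_)
  refine (norm_le_abs_re_add_abs_im _).trans ?_
  rw [log_re, log_im]
  exact add_le_add le_rfl (abs_arg_le_pi _)

/-- Euler's transformation, with boundary values on the cut. -/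
theorem gauss2F1_euler (σ : CutSide) (a b : ℂ) (hc : ∀ m : ℕ, c ≠ -(m : ℂ)) (hz : z ≠ 1) :
    gauss2F1 σ a b c z = exp (sideLog σ z * (c - a - b)) * gauss2F1 σ (c - a) (c - b) c z := by
  refine tendsto_nhds_unique (tendsto_gauss2F1 a b hc hz) (Tendsto.congr' ?_
    (((continuous_exp.tendsto _).comp ((tendsto_sideLog hz).mul_const (c - a - b))).mul
      (tendsto_gauss2F1 (σ := σ) (c - a) (c - b) hc hz)))
  filter_upwards [eventually_sideFilter_mem_cutPlane] with w hw
  rw [gaussPrincipal_euler a b hc hw, cpow_def_of_ne_zero (one_sub_ne_zero_of_mem_cutPlane hw)]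
  rfl

end EulerTransformation

/-! ### The two solutions and their comparison -/

section Solutions

open Complex

variable {a b c z : ℂ} {σ : CutSide} {K : Set ℂ}

/-- Euler's transformation at `1 - z` yields the factor `z^(1-c-n)`, its branch fixed by `sideLog`.
Its `n`-dependent part is the unambiguous `z^(-n)`, which joins `(-1)^n (1-z)^n`. -/
theorem solG_eq (σ : CutSide) (hg : ∀ m : ℕ, c - a - b + 1 ≠ -(m : ℂ)) (hz : z ≠ 0) (n : ℕ) :
    solG σ a b c z n = exp (sideLog σ (1 - z) * (1 - c)) * ((z - 1) / z) ^ n *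
      (Gamma (c + n) / Gamma (c - a - b + 1 + n)) *
      gauss2F1 σ (1 - b) (1 - a) (c - a - b + 1 + n) (1 - z) := by
  have h1 : 1 - z ≠ 1 := by simpa using hz
  have h2 : exp (sideLog σ (1 - z) * (1 - c - n)) = exp (sideLog σ (1 - z) * (1 - c)) / z ^ n := by
    rw [mul_sub, exp_sub, mul_comm _ (n : ℂ), exp_nat_mul, exp_sideLog h1, sub_sub_cancel]
  have h3 : ((z - 1) / z) ^ n = (-1) ^ n * (1 - z) ^ n / z ^ n := by
    rw [← mul_pow, ← div_pow]
    congr 2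
    ring
  rw [solG, gauss2F1_euler σ _ _ (not_neg_nat_add hg n) h1,
    show c - a - b + 1 + n - (c - a + n) = 1 - b by ring,
    show c - a - b + 1 + n - (c - b + n) = 1 - a by ring,
    show 1 - b - (c - b + n) = 1 - c - n by ring, h2, h3]
  ring

theorem isRecSolution_solF (σ : CutSide) (a b : ℂ) (hc : ∀ m : ℕ, c ≠ -(m : ℂ)) (hz : z ≠ 1) :
    IsRecSolution (recA c z) (recB a b c z) (recC a b c z) (solF σ a b c z) := by
  intro n hn
  obtain ⟨m, rfl⟩ : ∃ m, n = m + 1 := ⟨n - 1, by omega⟩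
  have h := gauss2F1_three_term σ a b (not_neg_nat_add hc m) hz
  have e1 : c + (m + 1 : ℕ) = c + m + 1 := by push_cast; ring
  have e2 : c + (m + 1 + 1 : ℕ) = c + m + 1 + 1 := by push_cast; ring
  simp only [recA, recB, recC, solF, Nat.add_sub_cancel, e1, e2]
  exact h

/-- The algebra behind the recurrence for `g_n`: with `N = c + m`, `d = c-a-b+1+m` and `T =
((z-1)/z)^m`, the prefactors of `solG_eq` turn the recurrence for parameters `1-b`, `1-a`, `d` at
`1-z` into the original one. -/
theorem three_term_conjugate {a b z N d φ₀ φ₁ φ₂ X T Γ₁ Γ₂ : ℂ} (hz : z ≠ 0) (hG : Γ₂ ≠ 0)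
    (hd₀ : d ≠ 0) (hd₁ : d + 1 ≠ 0) (hd : d = N - a - b + 1)
    (h : (d + 1) * (d + 1 - 1) * (1 - z - 1) * φ₀ +
      (d + 1) * (d + 1 - 1 - (2 * (d + 1) - (1 - b) - (1 - a) - 1) * (1 - z)) * φ₁ +
      (d + 1 - (1 - b)) * (d + 1 - (1 - a)) * (1 - z) * φ₂ = 0) :
    (N + 1) * (N + 1 - 1) * (z - 1) * (X * T * (Γ₁ / Γ₂) * φ₀) +
      (N + 1) * (N + 1 - 1 - (2 * (N + 1) - a - b - 1) * z) *
        (X * (T * ((z - 1) / z) ^ 1) * (N * Γ₁ / (d * Γ₂)) * φ₁) +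
      (N + 1 - a) * (N + 1 - b) * z * (X * (T * ((z - 1) / z) ^ 2) *
        ((N + 1) * (N * Γ₁) / ((d + 1) * (d * Γ₂))) * φ₂) = 0 := by
  have e : (N + 1) * (N + 1 - 1) * (z - 1) * (X * T * (Γ₁ / Γ₂) * φ₀) +
      (N + 1) * (N + 1 - 1 - (2 * (N + 1) - a - b - 1) * z) *
        (X * (T * ((z - 1) / z) ^ 1) * (N * Γ₁ / (d * Γ₂)) * φ₁) +
      (N + 1 - a) * (N + 1 - b) * z * (X * (T * ((z - 1) / z) ^ 2) *
        ((N + 1) * (N * Γ₁) / ((d + 1) * (d * Γ₂))) * φ₂) =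
      X * T * (Γ₁ / Γ₂) * N * (N + 1) * (z - 1) / ((d + 1) * d * z) * ((d + 1) * d * z * φ₀ +
        (d + 1) * (N + 1 - 1 - (2 * (N + 1) - a - b - 1) * z) * φ₁ +
        (N + 1 - a) * (N + 1 - b) * (z - 1) * φ₂) := by
    field_simp
    ring
  rw [e]
  refine mul_eq_zero_of_right _ ?_
  subst hd
  linear_combination (-1) * h

theorem isRecSolution_solG (σ : CutSide) (hc : ∀ m : ℕ, c ≠ -(m : ℂ))
    (hg : ∀ m : ℕ, c - a - b + 1 ≠ -(m : ℂ)) (hz0 : z ≠ 0) :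
    IsRecSolution (recA c z) (recB a b c z) (recC a b c z) (solG σ a b c z) := by
  intro n hn
  obtain ⟨m, rfl⟩ : ∃ m, n = m + 1 := ⟨n - 1, by omega⟩
  have h := gauss2F1_three_term σ (1 - b) (1 - a) (not_neg_nat_add hg m) (z := 1 - z)
    (by simpa using hz0)
  have hcm := add_nat_ne_zero hc m
  have hgm := add_nat_ne_zero hg m
  have hcm' : c + m + 1 ≠ 0 := ne_zero_of_not_neg_nat (not_neg_nat_add_one (not_neg_nat_add hc m))
  have hgm' : c - a - b + 1 + m + 1 ≠ 0 :=
    ne_zero_of_not_neg_nat (not_neg_nat_add_one (not_neg_nat_add hg m))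
  have hG : Gamma (c - a - b + 1 + m) ≠ 0 := Gamma_ne_zero (not_neg_nat_add hg m)
  have e1 : c + (m + 1 : ℕ) = c + m + 1 := by push_cast; ring
  have e2 : c + (m + 2 : ℕ) = c + m + 1 + 1 := by push_cast; ring
  have e3 : c - a - b + 1 + (m + 1 : ℕ) = c - a - b + 1 + m + 1 := by push_cast; ring
  have e4 : c - a - b + 1 + (m + 2 : ℕ) = c - a - b + 1 + m + 1 + 1 := by push_cast; ring
  have s₀ := solG_eq σ hg hz0 m
  have s₁ := solG_eq σ hg hz0 (m + 1)
  have s₂ := solG_eq σ hg hz0 (m + 2)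
  rw [e1, e3, Gamma_add_one _ hcm, Gamma_add_one _ hgm] at s₁
  rw [e2, e4, Gamma_add_one _ hcm', Gamma_add_one _ hgm', Gamma_add_one _ hcm,
    Gamma_add_one _ hgm] at s₂
  change A13 (c + (m + 1 : ℕ)) z * solG σ a b c z m +
    B13 a b (c + (m + 1 : ℕ)) z * solG σ a b c z (m + 1) +
    C13 a b (c + (m + 1 : ℕ)) z * solG σ a b c z (m + 2) = 0
  rw [s₀, s₁, s₂, e1, pow_add _ m 1, pow_add _ m 2]
  unfold A13 B13 C13 at h ⊢
  exact three_term_conjugate hz0 hG hgm hgm' (by ring) h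

theorem tendsto_solF (σ : CutSide) (a b : ℂ) (hc : ∀ m : ℕ, c ≠ -(m : ℂ)) (hz : z ≠ 1) :
    Tendsto (solF σ a b c z) atTop (𝓝 1) :=
  tendsto_gauss2F1_add_nat σ a b hc hz

theorem tendsto_solF_ratio (σ : CutSide) (a b : ℂ) (hc : ∀ m : ℕ, c ≠ -(m : ℂ)) (hz : z ≠ 1) :
    Tendsto (fun n : ℕ => solF σ a b c z (n + 1) / solF σ a b c z n) atTop (𝓝 1) := by
  have h := tendsto_solF σ a b hc hz
  have h2 := (h.comp (tendsto_add_atTop_nat 1)).div h one_ne_zero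
  rw [div_one] at h2
  exact h2

theorem tendsto_solG_ratio (σ : CutSide) (hc : ∀ m : ℕ, c ≠ -(m : ℂ))
    (hg : ∀ m : ℕ, c - a - b + 1 ≠ -(m : ℂ)) (hz0 : z ≠ 0) (hz1 : z ≠ 1) :
    Tendsto (fun n : ℕ => solG σ a b c z (n + 1) / solG σ a b c z n) atTop
      (𝓝 ((z - 1) / z)) := by
  have h := tendsto_gauss2F1_add_nat σ (1 - b) (1 - a) hg (z := 1 - z) (by simpa using hz0)
  have h2 := (h.comp (tendsto_add_atTop_nat 1)).div h one_ne_zero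
  have h3 := ((tendsto_add_nat_div_add_nat c (c - a - b + 1)).mul_const ((z - 1) / z)).mul h2
  simp only [one_mul, div_one, mul_one] at h3
  refine h3.congr' ?_
  filter_upwards [h.eventually_ne one_ne_zero] with n hn
  have hz1' : z - 1 ≠ 0 := sub_ne_zero.2 hz1
  have e1 : c + (n + 1 : ℕ) = c + n + 1 := by push_cast; ring
  have e2 : c - a - b + 1 + (n + 1 : ℕ) = c - a - b + 1 + n + 1 := by push_cast; ring
  have hcn := add_nat_ne_zero hc n
  have hgn := add_nat_ne_zero hg n
  have hG1 : Gamma (c - a - b + 1 + n) ≠ 0 := Gamma_ne_zero (not_neg_nat_add hg n)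
  have hG2 : Gamma (c + n) ≠ 0 := Gamma_ne_zero (not_neg_nat_add hc n)
  have hexp := exp_ne_zero (sideLog σ (1 - z) * (1 - c))
  simp only [solG_eq σ hg hz0, Pi.div_apply, Function.comp_apply, e1, e2, Gamma_add_one _ hcn,
    Gamma_add_one _ hgn, pow_succ]
  field_simp

/-- Proportional nonzero sequences have equal successive quotients, hence equal limits. -/
theorem linearIndependent_of_tendsto_ratio {f g : ℕ → ℂ} {s t : ℂ}
    (hf : Tendsto (fun n => f (n + 1) / f n) atTop (𝓝 s))
    (hg : Tendsto (fun n => g (n + 1) / g n) atTop (𝓝 t)) (hs : s ≠ 0) (ht : t ≠ 0)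
    (hst : s ≠ t) : LinearIndependent ℂ ![f, g] := by
  rw [LinearIndependent.pair_iff]
  intro α β h
  have hf0 : ∃ n, f n ≠ 0 := by
    obtain ⟨n, hn⟩ := (hf.eventually_ne hs).exists
    exact ⟨n, fun h0 => hn (by rw [h0, div_zero])⟩
  have hg0 : ∃ n, g n ≠ 0 := by
    obtain ⟨n, hn⟩ := (hg.eventually_ne ht).exists
    exact ⟨n, fun h0 => hn (by rw [h0, div_zero])⟩
  have hn : ∀ n, α * f n + β * g n = 0 := fun n => by simpa using congrFun h n
  have hβ : β = 0 := by
    by_contra hβ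
    have hα : α ≠ 0 := by
      rintro rfl
      obtain ⟨n, hgn⟩ := hg0
      simpa [hβ, hgn] using hn n
    refine hst (tendsto_nhds_unique hf (hg.congr fun n => ?_))
    have e : ∀ n, g n = -(α / β) * f n := fun n => by
      field_simp
      linear_combination hn n
    rw [e, e, mul_div_mul_left _ _ (neg_ne_zero.2 (div_ne_zero hα hβ))]
  refine ⟨?_, hβ⟩
  obtain ⟨n, hfn⟩ := hf0
  simpa [hβ, hfn] using hn n

theorem linearIndependent_solF_solG (σ : CutSide) (hc : ∀ m : ℕ, c ≠ -(m : ℂ))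
    (hg : ∀ m : ℕ, c - a - b + 1 ≠ -(m : ℂ)) (hz0 : z ≠ 0) (hz1 : z ≠ 1) :
    LinearIndependent ℂ ![solF σ a b c z, solG σ a b c z] := by
  refine linearIndependent_of_tendsto_ratio (tendsto_solF_ratio σ a b hc hz1)
    (tendsto_solG_ratio σ hc hg hz0 hz1) one_ne_zero (div_ne_zero (sub_ne_zero.2 hz1) hz0) ?_
  intro h
  rw [eq_div_iff hz0] at h
  exact one_ne_zero (by linear_combination h : (1 : ℂ) = 0)

/-- The reflection formula turns `Γ(a+b-c-n)` into `1/Γ(c-a-b+1+n)`, and the sine contributes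
`(-1)^n`. -/
theorem connectionTerm_eq (σ : CutSide) (hz : z ≠ 1)
    (hab : ∀ m : ℤ, a + b - c ≠ (m : ℂ)) (n : ℕ) :
    connectionTerm σ a b (c + n) z =
      (Real.pi : ℂ) / (sin (Real.pi * (a + b - c)) * (Gamma a * Gamma b)) *
        (1 - z) ^ (c - a - b) * solG σ a b c z n := by
  have h1 : 1 - z ≠ 0 := sub_ne_zero.2 hz.symm
  have h2 := Gamma_mul_Gamma_one_sub (a + b - (c + n))
  have h3 : sin (Real.pi * (a + b - (c + n))) = (-1) ^ n * sin (Real.pi * (a + b - c)) := by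
    rw [show (Real.pi : ℂ) * (a + b - (c + n)) = Real.pi * (a + b - c) - n * Real.pi by ring,
      sin_antiperiodic.sub_nat_mul_eq]
  have h4 : Gamma (c - a - b + 1 + n) ≠ 0 := by
    refine Gamma_ne_zero fun m hm => hab (m + n + 1 : ℤ) ?_
    push_cast
    linear_combination -hm
  have h5 : (1 - z) ^ (c + n - a - b) = (1 - z) ^ (c - a - b) * (1 - z) ^ n := by
    rw [show c + n - a - b = c - a - b + n by ring, cpow_add _ _ h1, cpow_natCast]
  have h6 : sin (Real.pi * (a + b - c)) ≠ 0 := by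
    rw [Ne, sin_eq_zero_iff]
    rintro ⟨k, hk⟩
    refine hab k (mul_left_cancel₀ (ofReal_ne_zero.2 Real.pi_ne_zero) ?_)
    rw [hk, mul_comm]
  have h7 : Gamma (a + b - (c + n)) = (Real.pi : ℂ) * (-1) ^ n /
      (sin (Real.pi * (a + b - c)) * Gamma (c - a - b + 1 + n)) := by
    rw [show 1 - (a + b - (c + n)) = c - a - b + 1 + n by ring, h3] at h2
    rw [eq_div_of_mul_eq h4 h2]
    have h8 : ((-1 : ℂ) ^ n) * (-1) ^ n = 1 := by rw [← mul_pow]; simp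
    have h9 : ((-1 : ℂ) ^ n) ≠ 0 := by simp
    field_simp
    linear_combination (-1 : ℂ) * h8
  rw [connectionTerm, solG, h5, h7, show c + n - a = c - a + n by ring,
    show c + n - b = c - b + n by ring, show c - a + n - b + 1 = c - a - b + 1 + n by ring]
  ring

theorem tendsto_recB_div_recC (a b c : ℂ) (hz : z ≠ 0) :
    Tendsto (fun n : ℕ => recB a b c z n / recC a b c z n) atTop (𝓝 (-(2 * z - 1) / z)) := by
  have h1 := (tendsto_add_mul_div_add_mul_atTop_nhds ((1 - 2 * z) * c - 1 + (a + b + 1) * z)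
    (c - b) (1 - 2 * z) one_ne_zero).mul (tendsto_add_nat_div_add_nat c (c - a))
  have h2 := h1.div_const z
  rw [show (1 - 2 * z) / 1 * 1 / z = -(2 * z - 1) / z by ring] at h2
  refine h2.congr' ?_
  filter_upwards [eventually_add_nat_ne_zero (c - a), eventually_add_nat_ne_zero (c - b)]
    with n h3 h4
  have h3' : c + n - a ≠ 0 := by rwa [add_sub_right_comm]
  have h4' : c + n - b ≠ 0 := by rwa [add_sub_right_comm]
  simp only [recB, recC, B13, C13, one_mul]
  field_simp
  ring

theorem tendsto_recA_div_recC (a b c : ℂ) (hz : z ≠ 0) :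
    Tendsto (fun n : ℕ => recA c z n / recC a b c z n) atTop (𝓝 ((z - 1) / z)) := by
  have h1 := ((tendsto_add_nat_div_add_nat c (c - a)).mul
    (tendsto_add_nat_div_add_nat (c - 1) (c - b))).mul_const ((z - 1) / z)
  rw [one_mul, one_mul] at h1
  refine h1.congr' ?_
  filter_upwards [eventually_add_nat_ne_zero (c - a), eventually_add_nat_ne_zero (c - b)]
    with n h3 h4
  have h3' : c + n - a ≠ 0 := by rwa [add_sub_right_comm]
  have h4' : c + n - b ≠ 0 := by rwa [add_sub_right_comm]
  simp only [recA, recC, A13, C13]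
  field_simp
  ring

theorem norm_sub_one_eq_norm_iff : ‖z - 1‖ = ‖z‖ ↔ z.re = 1 / 2 := by
  rw [← sq_eq_sq₀ (norm_nonneg _) (norm_nonneg _), Complex.sq_norm, Complex.sq_norm, normSq_apply,
    normSq_apply]
  simp only [sub_re, one_re, sub_im, one_im, sub_zero]
  constructor <;> intro h <;> nlinarith

theorem isBigO_solF_sub_one (σ : CutSide) (a b : ℂ) (hc : ∀ m : ℕ, c ≠ -(m : ℂ)) (hz : z ≠ 1) :
    (fun n : ℕ => solF σ a b c z n - 1) =O[atTop] fun n : ℕ => 1 / (n : ℝ) := by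
  obtain ⟨M, hM⟩ := exists_bound_gauss2F1_sub_one σ a b hc (isCompact_singleton (x := z))
    fun h => hz (Set.mem_singleton_iff.1 h).symm
  refine Asymptotics.IsBigO.of_bound M (hM.mono fun n hn => ?_)
  rw [norm_div, norm_one, Real.norm_natCast, mul_one_div]
  exact hn z rfl

/-- Exponential decay beats quotients of Gamma functions. -/
theorem tendsto_pow_mul_Gamma_div_Gamma {u v : ℂ} (hu : ∀ m : ℕ, u ≠ -(m : ℂ))
    (hv : ∀ m : ℕ, v ≠ -(m : ℂ)) {ρ : ℝ} (hρ0 : 0 ≤ ρ) (hρ : ρ < 1) :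
    Tendsto (fun n : ℕ => ρ ^ n * ‖Gamma (u + n) / Gamma (v + n)‖) atTop (𝓝 0) := by
  -- Unlike `ρ`, `τ` is never zero, so the ratio test applies to nonvanishing terms.
  set τ := (1 + ρ) / 2 with hτ
  have hτ0 : 0 < τ := by linarith
  have hs : Summable fun n : ℕ => τ ^ n * ‖Gamma (u + n) / Gamma (v + n)‖ := by
    have hne : ∀ n : ℕ, τ ^ n * ‖Gamma (u + n) / Gamma (v + n)‖ ≠ 0 := fun n =>
      mul_ne_zero (pow_ne_zero _ hτ0.ne') (norm_ne_zero_iff.2 (div_ne_zero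
        (Gamma_ne_zero (not_neg_nat_add hu n)) (Gamma_ne_zero (not_neg_nat_add hv n))))
    refine summable_of_ratio_test_tendsto_lt_one (by linarith : τ < 1) (.of_forall hne) ?_
    have h := ((tendsto_add_nat_div_add_nat u v).norm).const_mul τ
    rw [norm_one, mul_one] at h
    refine h.congr fun n => ?_
    rw [← norm_div, Nat.cast_succ, ← add_assoc, ← add_assoc, Gamma_add_one _ (add_nat_ne_zero hu n),
      Gamma_add_one _ (add_nat_ne_zero hv n), mul_div_mul_comm, norm_mul, pow_succ, norm_div]
    have h1 : ‖Gamma (u + n)‖ ≠ 0 := norm_ne_zero_iff.2 (Gamma_ne_zero (not_neg_nat_add hu n))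
    have h2 : ‖Gamma (v + n)‖ ≠ 0 := norm_ne_zero_iff.2 (Gamma_ne_zero (not_neg_nat_add hv n))
    have h3 : ‖v + n‖ ≠ 0 := norm_ne_zero_iff.2 (add_nat_ne_zero hv n)
    simp only [norm_mul, norm_div, norm_norm, norm_pow, Real.norm_of_nonneg hτ0.le]
    field_simp
  refine squeeze_zero (fun n => by positivity) (fun n => ?_) hs.tendsto_atTop_zero
  gcongr
  linarith

/-- Two-sided bounds for the two solutions, uniform on compact sets avoiding `0` and `1`. -/
theorem exists_bounds_solF_solG (σ : CutSide) (hc : ∀ m : ℕ, c ≠ -(m : ℂ))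
    (hg : ∀ m : ℕ, c - a - b + 1 ≠ -(m : ℂ)) (hK : IsCompact K) (h0 : (0 : ℂ) ∉ K)
    (h1 : (1 : ℂ) ∉ K) :
    ∃ E : ℝ, 0 < E ∧ ∀ᶠ n : ℕ in atTop, ∀ z ∈ K,
      1 / 2 ≤ ‖solF σ a b c z n‖ ∧ ‖solF σ a b c z n‖ ≤ 2 ∧
      ‖solG σ a b c z n‖ ≤
        E * (‖(z - 1) / z‖ ^ n * ‖Gamma (c + n) / Gamma (c - a - b + 1 + n)‖) ∧
      ‖(z - 1) / z‖ ^ n * ‖Gamma (c + n) / Gamma (c - a - b + 1 + n)‖ ≤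
        E * ‖solG σ a b c z n‖ := by
  obtain ⟨M₁, hM₁⟩ := exists_bound_gauss2F1_sub_one σ a b hc hK h1
  obtain ⟨M₂, hM₂⟩ := exists_bound_gauss2F1_sub_one σ (1 - b) (1 - a) hg
    (hK.image (by fun_prop : Continuous fun z : ℂ => 1 - z)) (by
      rintro ⟨z, hz, hz'⟩
      have : z = 0 := by simpa using hz'
      exact h0 (this ▸ hz))
  have hne : ∀ z ∈ K, z ≠ 0 := fun z hz h => h0 (h ▸ hz)
  obtain ⟨R, hR⟩ := hK.exists_bound_of_continuousOn (f := fun z : ℂ => Real.log ‖z‖)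
    (ContinuousOn.log (by fun_prop) fun z hz => norm_ne_zero_iff.2 (hne z hz))
  -- `E₀` bounds both the exponential factor of `solG_eq` and its inverse; `R` controls `log ‖z‖`
  -- and `π` the argument.
  set E₀ := Real.exp ((R + Real.pi) * ‖1 - c‖) with hE₀
  have hE₀0 : 0 < E₀ := Real.exp_pos _
  have hsmall : ∀ M : ℝ, ∀ᶠ n : ℕ in atTop, M / n < 1 / 2 := fun M =>
    (tendsto_const_div_atTop_nhds_zero_nat M).eventually_lt_const (by norm_num)
  have hclose : ∀ w : ℂ, ‖w - 1‖ ≤ 1 / 2 → 1 / 2 ≤ ‖w‖ ∧ ‖w‖ ≤ 2 := by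
    intro w hw
    have e1 := norm_le_norm_sub_add w 1
    have e2 := norm_sub_norm_le (1 : ℂ) w
    rw [norm_sub_rev] at e2
    rw [norm_one] at e1 e2
    constructor <;> linarith
  refine ⟨2 * E₀, by positivity, ?_⟩
  filter_upwards [hM₁, hM₂, hsmall M₁, hsmall M₂] with n e1 e2 e3 e4 z hz
  have f1 := hclose _ ((e1 z hz).trans e3.le)
  obtain ⟨f2, f3⟩ := hclose _ ((e2 (1 - z) ⟨z, hz, rfl⟩).trans e4.le)
  refine ⟨f1.1, f1.2, ?_⟩
  have hlog : ‖sideLog σ (1 - z) * (1 - c)‖ ≤ (R + Real.pi) * ‖1 - c‖ := by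
    rw [norm_mul]
    gcongr
    have := norm_sideLog_le (σ := σ) (z := 1 - z) (by simpa using hne z hz)
    rw [sub_sub_cancel] at this
    exact this.trans (add_le_add (hR z hz) le_rfl)
  have g1 : ‖exp (sideLog σ (1 - z) * (1 - c))‖ ≤ E₀ :=
    (norm_exp_le_exp_norm _).trans (Real.exp_le_exp.2 hlog)
  have g2 : 1 ≤ E₀ * ‖exp (sideLog σ (1 - z) * (1 - c))‖ := by
    rw [norm_exp, hE₀, ← Real.exp_add, Real.one_le_exp_iff]
    have := neg_abs_le (sideLog σ (1 - z) * (1 - c)).re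
    linarith [abs_re_le_norm (sideLog σ (1 - z) * (1 - c))]
  rw [solG_eq σ hg (hne z hz), norm_mul, norm_mul, norm_mul, norm_pow]
  set κ := ‖exp (sideLog σ (1 - z) * (1 - c))‖
  set φ := ‖gauss2F1 σ (1 - b) (1 - a) (c - a - b + 1 + n) (1 - z)‖
  set T := ‖(z - 1) / z‖ ^ n
  set γ := ‖Gamma (c + n) / Gamma (c - a - b + 1 + n)‖
  have hTγ : 0 ≤ T * γ := by positivity
  constructor
  · calc κ * T * γ * φ = κ * φ * (T * γ) := by ring
      _ ≤ E₀ * 2 * (T * γ) := by gcongr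
      _ = 2 * E₀ * (T * γ) := by ring
  · calc T * γ = 1 * (2 * (1 / 2)) * (T * γ) := by ring
      _ ≤ (E₀ * κ) * (2 * φ) * (T * γ) := by gcongr
      _ = 2 * E₀ * (κ * T * γ * φ) := by ring

theorem left_uniform (σ : CutSide) (hc : ∀ m : ℕ, c ≠ -(m : ℂ))
    (hg : ∀ m : ℕ, c - a - b + 1 ≠ -(m : ℂ)) (hK : IsCompact K)
    (hKs : K ⊆ {z : ℂ | z ≠ 0 ∧ z.re < 1 / 2}) :
    (∀ᶠ n : ℕ in atTop, ∀ z ∈ K, solG σ a b c z n ≠ 0) ∧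
      TendstoUniformlyOn (fun (n : ℕ) (z : ℂ) => solF σ a b c z n / solG σ a b c z n)
        (fun _ => 0) atTop K := by
  have h0 : (0 : ℂ) ∉ K := fun h => (hKs h).1 rfl
  have h1 : (1 : ℂ) ∉ K := fun h => by
    have := (hKs h).2
    norm_num at this
  obtain ⟨E, hE0, hE⟩ := exists_bounds_solF_solG (a := a) (b := b) σ hc hg hK h0 h1
  -- The reflection `z ↦ 1 - z` moves `K` to the right of the line and, up to sign, inverts
  -- `(z-1)/z` to `z/(z-1)` without changing the modulus of that inverse.
  obtain ⟨ρ, hρ0, hρ1, hρ⟩ := exists_ratio_bound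
    (hK.image (by fun_prop : Continuous fun z : ℂ => 1 - z)) (by
      rintro _ ⟨z, hz, rfl⟩
      have := (hKs hz).2
      simp only [sub_re, one_re]
      linarith)
  have hpos : ∀ z ∈ K, ∀ n : ℕ,
      0 < ‖(z - 1) / z‖ ^ n * ‖Gamma (c + n) / Gamma (c - a - b + 1 + n)‖ := fun z hz n =>
    mul_pos (pow_pos (norm_pos_iff.2 (div_ne_zero (sub_ne_zero.2 (ne_of_mem_of_not_mem hz h1))
      (ne_of_mem_of_not_mem hz h0))) _) (norm_pos_iff.2 (div_ne_zero
        (Gamma_ne_zero (not_neg_nat_add hc n)) (Gamma_ne_zero (not_neg_nat_add hg n))))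
  have hne : ∀ᶠ n : ℕ in atTop, ∀ z ∈ K, solG σ a b c z n ≠ 0 := by
    filter_upwards [hE] with n hn z hz h
    have := (hn z hz).2.2.2
    rw [h, norm_zero, mul_zero] at this
    linarith [hpos z hz n]
  refine ⟨hne, Metric.tendstoUniformlyOn_iff.2 fun ε hε => ?_⟩
  have hlim := (tendsto_pow_mul_Gamma_div_Gamma hg hc hρ0 hρ1).const_mul (2 * E)
  rw [mul_zero] at hlim
  filter_upwards [hE, hne, hlim.eventually_lt_const hε] with n hn hn0 hnε z hz
  rw [dist_zero_left]
  refine lt_of_le_of_lt ?_ hnε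
  obtain ⟨-, e2, -, e4⟩ := hn z hz
  have hinv : ‖(z - 1) / z‖⁻¹ ≤ ρ := by
    have := hρ (1 - z) ⟨z, hz, rfl⟩
    rw [← norm_inv, inv_div]
    convert! this using 1
    rw [norm_div, norm_div, norm_sub_rev z 1]
    simp
  have hT := hpos z hz n
  have e5 : ‖solG σ a b c z n‖⁻¹ ≤
      E * (‖(z - 1) / z‖ ^ n * ‖Gamma (c + n) / Gamma (c - a - b + 1 + n)‖)⁻¹ := by
    rw [← div_eq_mul_inv, le_div_iff₀ hT, inv_mul_le_iff₀ (norm_pos_iff.2 (hn0 z hz)), mul_comm _ E]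
    exact e4
  calc ‖solF σ a b c z n / solG σ a b c z n‖ = ‖solF σ a b c z n‖ * ‖solG σ a b c z n‖⁻¹ := by
        rw [norm_div, div_eq_mul_inv]
    _ ≤ 2 * (E * (‖(z - 1) / z‖ ^ n * ‖Gamma (c + n) / Gamma (c - a - b + 1 + n)‖)⁻¹) := by gcongr
    _ = 2 * E * ((‖(z - 1) / z‖⁻¹) ^ n * ‖Gamma (c - a - b + 1 + n) / Gamma (c + n)‖) := by
        rw [mul_inv, inv_pow, ← norm_inv (Gamma _ / Gamma _), inv_div]
        ring
    _ ≤ 2 * E * (ρ ^ n * ‖Gamma (c - a - b + 1 + n) / Gamma (c + n)‖) := by gcongr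

theorem right_uniform (σ : CutSide) (hc : ∀ m : ℕ, c ≠ -(m : ℂ))
    (hg : ∀ m : ℕ, c - a - b + 1 ≠ -(m : ℂ)) (hK : IsCompact K)
    (hKs : K ⊆ {z : ℂ | z ≠ 1 ∧ 1 / 2 < z.re}) :
    (∀ᶠ n : ℕ in atTop, ∀ z ∈ K, solF σ a b c z n ≠ 0) ∧
      TendstoUniformlyOn (fun (n : ℕ) (z : ℂ) => solG σ a b c z n / solF σ a b c z n)
        (fun _ => 0) atTop K := by
  have h1 : (1 : ℂ) ∉ K := fun h => (hKs h).1 rfl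
  have h0 : (0 : ℂ) ∉ K := fun h => by
    have := (hKs h).2
    norm_num at this
  obtain ⟨E, hE0, hE⟩ := exists_bounds_solF_solG (a := a) (b := b) σ hc hg hK h0 h1
  obtain ⟨ρ, hρ0, hρ1, hρ⟩ := exists_ratio_bound hK fun z hz => (hKs hz).2
  have hne : ∀ᶠ n : ℕ in atTop, ∀ z ∈ K, solF σ a b c z n ≠ 0 := by
    filter_upwards [hE] with n hn z hz h
    have := (hn z hz).1
    rw [h, norm_zero] at this
    norm_num at this
  refine ⟨hne, Metric.tendstoUniformlyOn_iff.2 fun ε hε => ?_⟩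
  have hlim := (tendsto_pow_mul_Gamma_div_Gamma hc hg hρ0 hρ1).const_mul (2 * E)
  rw [mul_zero] at hlim
  filter_upwards [hE, hne, hlim.eventually_lt_const hε] with n hn hn0 hnε z hz
  rw [dist_zero_left]
  refine lt_of_le_of_lt ?_ hnε
  obtain ⟨e1, -, e3, -⟩ := hn z hz
  rw [norm_div, div_le_iff₀ (norm_pos_iff.2 (hn0 z hz))]
  calc ‖solG σ a b c z n‖ ≤
      E * (‖(z - 1) / z‖ ^ n * ‖Gamma (c + n) / Gamma (c - a - b + 1 + n)‖) := e3
    _ ≤ E * (ρ ^ n * ‖Gamma (c + n) / Gamma (c - a - b + 1 + n)‖) := by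
        gcongr
        exact hρ z hz
    _ = 2 * E * (ρ ^ n * ‖Gamma (c + n) / Gamma (c - a - b + 1 + n)‖) * (1 / 2) := by ring
    _ ≤ _ := by gcongr

theorem isMinimalDominantPair_left (σ : CutSide) (hc : ∀ m : ℕ, c ≠ -(m : ℂ))
    (hg : ∀ m : ℕ, c - a - b + 1 ≠ -(m : ℂ)) (hz0 : z ≠ 0) (hz : z.re < 1 / 2) :
    IsMinimalDominantPair (recA c z) (recB a b c z) (recC a b c z) (solF σ a b c z)
      (solG σ a b c z) := by
  have hz1 : z ≠ 1 := by
    rintro rfl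
    norm_num at hz
  obtain ⟨h1, h2⟩ := left_uniform (a := a) (b := b) σ hc hg (isCompact_singleton (x := z))
    (Set.singleton_subset_iff.2 ⟨hz0, hz⟩)
  exact ⟨isRecSolution_solF σ a b hc hz1, isRecSolution_solG σ hc hg hz0,
    linearIndependent_solF_solG σ hc hg hz0 hz1, h1.mono fun n hn => hn z rfl,
    h2.tendsto_at rfl⟩

theorem isMinimalDominantPair_right (σ : CutSide) (hc : ∀ m : ℕ, c ≠ -(m : ℂ))
    (hg : ∀ m : ℕ, c - a - b + 1 ≠ -(m : ℂ)) (hz1 : z ≠ 1) (hz : 1 / 2 < z.re) :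
    IsMinimalDominantPair (recA c z) (recB a b c z) (recC a b c z) (solG σ a b c z)
      (solF σ a b c z) := by
  have hz0 : z ≠ 0 := by
    rintro rfl
    norm_num at hz
  obtain ⟨h1, h2⟩ := right_uniform (a := a) (b := b) σ hc hg (isCompact_singleton (x := z))
    (Set.singleton_subset_iff.2 ⟨hz1, hz⟩)
  exact ⟨isRecSolution_solG σ hc hg hz0, isRecSolution_solF σ a b hc hz1,
    LinearIndependent.pair_symm_iff.1 (linearIndependent_solF_solG σ hc hg hz0 hz1),
    h1.mono fun n hn => hn z rfl, h2.tendsto_at rfl⟩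

end Solutions

theorem mainTheorem5 (σ : CutSide) (a b c : ℂ)
    (hc : ∀ m : ℕ, c ≠ -(m : ℂ)) (hg : ∀ m : ℕ, c - a - b + 1 ≠ -(m : ℂ)) :
    -- two linearly independent solutions
    (∀ z : ℂ, z ≠ 0 → z ≠ 1 →
      IsRecSolution (recA c z) (recB a b c z) (recC a b c z) (solF σ a b c z) ∧
      IsRecSolution (recA c z) (recB a b c z) (recC a b c z) (solG σ a b c z) ∧
      LinearIndependent ℂ ![solF σ a b c z, solG σ a b c z]) ∧
    -- up to a factor that does not depend on `n`, the second solution is the second term of the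
    -- connection formula with `c` replaced by `c + n`
    (∀ z : ℂ, z ≠ 0 → z ≠ 1 → (∀ m : ℤ, a + b - c ≠ (m : ℂ)) → ∀ n : ℕ,
      connectionTerm σ a b (c + n) z =
        (Real.pi : ℂ) / (Complex.sin (Real.pi * (a + b - c)) *
          (Complex.Gamma a * Complex.Gamma b)) * (1 - z) ^ (c - a - b) * solG σ a b c z n) ∧
    -- the limits of the coefficient ratios, and the roots of the characteristic polynomial
    (∀ z : ℂ, z ≠ 0 → z ≠ 1 →
      Tendsto (fun n : ℕ => recB a b c z n / recC a b c z n) atTop (𝓝 (-(2 * z - 1) / z)) ∧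
      Tendsto (fun n : ℕ => recA c z n / recC a b c z n) atTop (𝓝 ((z - 1) / z)) ∧
      (∀ t : ℂ, t ^ 2 + (-(2 * z - 1) / z) * t + (z - 1) / z = 0 ↔ t = 1 ∨ t = (z - 1) / z) ∧
      (‖(1 : ℂ)‖ = ‖(z - 1) / z‖ ↔ z.re = 1 / 2) ∧
      (‖(1 : ℂ)‖ > ‖(z - 1) / z‖ ↔ z.re > 1 / 2)) ∧
    -- the behaviour of the two solutions for large `n`
    (∀ z : ℂ, z ≠ 0 → z ≠ 1 →
      (fun n : ℕ => solF σ a b c z n - 1) =O[atTop] (fun n : ℕ => 1 / (n : ℝ)) ∧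
      Tendsto (fun n : ℕ => solF σ a b c z (n + 1) / solF σ a b c z n) atTop (𝓝 1) ∧
      Tendsto (fun n : ℕ => solG σ a b c z (n + 1) / solG σ a b c z n) atTop
        (𝓝 ((z - 1) / z))) ∧
    -- left of the line `Re z = 1/2`
    (∀ z : ℂ, z ≠ 0 → z.re < 1 / 2 →
      IsMinimalSolution (recA c z) (recB a b c z) (recC a b c z) (solF σ a b c z) ∧
      IsDominantSolution (recA c z) (recB a b c z) (recC a b c z) (solG σ a b c z)) ∧
    (∀ K : Set ℂ, IsCompact K → K ⊆ {z : ℂ | z ≠ 0 ∧ z.re < 1 / 2} →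
      (∀ᶠ n : ℕ in atTop, ∀ z ∈ K, solG σ a b c z n ≠ 0) ∧
      TendstoUniformlyOn (fun (n : ℕ) (z : ℂ) => solF σ a b c z n / solG σ a b c z n)
        (fun _ => 0) atTop K) ∧
    -- right of the line `Re z = 1/2`
    (∀ z : ℂ, z ≠ 1 → 1 / 2 < z.re →
      IsMinimalSolution (recA c z) (recB a b c z) (recC a b c z) (solG σ a b c z) ∧
      IsDominantSolution (recA c z) (recB a b c z) (recC a b c z) (solF σ a b c z)) ∧
    (∀ K : Set ℂ, IsCompact K → K ⊆ {z : ℂ | z ≠ 1 ∧ 1 / 2 < z.re} →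
      (∀ᶠ n : ℕ in atTop, ∀ z ∈ K, solF σ a b c z n ≠ 0) ∧
      TendstoUniformlyOn (fun (n : ℕ) (z : ℂ) => solG σ a b c z n / solF σ a b c z n)
        (fun _ => 0) atTop K) := by
  refine ⟨fun z hz0 hz1 => ⟨isRecSolution_solF σ a b hc hz1, isRecSolution_solG σ hc hg hz0,
    linearIndependent_solF_solG σ hc hg hz0 hz1⟩,
    fun z _ hz1 hab n => connectionTerm_eq σ hz1 hab n,
    fun z hz0 hz1 => ⟨tendsto_recB_div_recC a b c hz0, tendsto_recA_div_recC a b c hz0,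
      fun t => ?_, ?_, ?_⟩,
    fun z hz0 hz1 => ⟨isBigO_solF_sub_one σ a b hc hz1, tendsto_solF_ratio σ a b hc hz1,
      tendsto_solG_ratio σ hc hg hz0 hz1⟩,
    fun z hz0 hz => ⟨⟨_, isMinimalDominantPair_left σ hc hg hz0 hz⟩,
      ⟨_, isMinimalDominantPair_left σ hc hg hz0 hz⟩⟩,
    fun K hK hKs => left_uniform σ hc hg hK hKs,
    fun z hz1 hz => ⟨⟨_, isMinimalDominantPair_right σ hc hg hz1 hz⟩,
      ⟨_, isMinimalDominantPair_right σ hc hg hz1 hz⟩⟩,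
    fun K hK hKs => right_uniform σ hc hg hK hKs⟩
  · rw [show t ^ 2 + (-(2 * z - 1) / z) * t + (z - 1) / z = (t - 1) * (t - (z - 1) / z) by
      field_simp; ring, mul_eq_zero, sub_eq_zero, sub_eq_zero]
  · rw [norm_one, norm_div, eq_comm, div_eq_one_iff_eq (norm_ne_zero_iff.2 hz0),
      norm_sub_one_eq_norm_iff]
  · rw [norm_one, norm_div, gt_iff_lt, div_lt_one (norm_pos_iff.2 hz0), norm_sub_one_lt_norm_iff]
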